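/- Let $k$ be an algebraically closed field of characteristic $0$, let $X$ be the complete toric variety of a complete fan $\Sigma$ in $\mathbb{R}^n$ with respect to the lattice $\mathbb{Z}^n$, and let $S=k[x_\rho \mid \rho\in\Sigma(1)]=\bigoplus_{\alpha\in \mathrm{Cl}(X)}S_\alpha$ be its Cox ring, graded by $\deg x_\rho=[D_\rho]\in\mathrm{Cl}(X)$. Let $\mathrm{Aut}_{\mathrm{gr}}(S)$ be the group (under composition) of graded $k$-algebra automorphisms of $S$. Let $\alpha_1,\dots,\alpha_l$ be the distinct degrees of the variables, and write $S_i=S_{\alpha_i}=S_i'\oplus S_i''$, where $S_i'$ is spanned by the variables of degree $\alpha_i$ and $S_i''$ by the other monomials of degree $\alpha_i$. Via $\phi\mapsto(\phi|_{S_i})_{i}$, expressed in the monomial bases (columns are images of basis elements), $\mathrm{Aut}_{\mathrm{gr}}(S)$ is a Zariski closed subgroup of $\prod_i \mathrm{GL}(S_i)$. Order the monomial basis of each $S_i''$ by any linear order in which monomials of smaller total degree come first. (1) The unipotent radical $U$ of $\mathrm{Aut}_{\mathrm{gr}}(S)$ consists of exactly those $\phi\in \mathrm{Aut}_{\mathrm{gr}}(S)$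 such that, for every $i$, the matrix of $\phi|_{S_i}$ has the form $$\begin{pmatrix} I_i & 0\\ B_i & C_i\end{pmatrix}$$ with $C_i$ lower triangular with $1$'s on the diagonal. (2) There is a Levi decomposition $\mathrm{Aut}_{\mathrm{gr}}(S)=R\ltimes U$ ($R$ a closed reductive subgroup) such that $\lambda_g:\mathbb{G}_m\to \mathrm{Aut}_{\mathrm{gr}}(S)$, $t\mapsto(x_\rho\mapsto t^{-1}x_\rho)$, is a one-parameter subgroup of the centre of $R$, and $\lambda_g$ grades $U$ positively: under the action $u\mapsto\lambda_g(t^{-1})\,u\,\lambda_g(t)$ of $t\in\mathbb{G}_m$ on $U$, $\mathrm{Lie}\,U$ is the direct sum of its weight spaces and all its weights are positive. (3) Consequently $\mathrm{Aut}_{\mathrm{gr}}(S)$ has a graded unipotent radical: there are a Levi decomposition $\mathrm{Aut}_{\mathrm{gr}}(S)=R\ltimes U$ and a one-parameter subgroup $\lambda:\mathbb{G}_m\to R$, central in $R$, such that the action $u\mapsto\lambda(t)\,u\,\lambda(t)^{-1}$ on $U$ has only positive weights on $\mathrm{Lie}\,U$. -/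

import Mathlib

noncomputable section

namespace ToricCox

/-! ## Fans -/

/-- The vector of `N_ℝ = ℝⁿ` given by a vector of the lattice `N = ℤⁿ`. -/
def realVec {n : ℕ} (u : Fin n → ℤ) : Fin n → ℝ := fun i => (u i : ℝ)

/-- A lattice vector is primitive if its coordinates have greatest common divisor `1`. -/
def IsPrimitive {n : ℕ} (u : Fin n → ℤ) : Prop := Finset.univ.gcd u = 1

/-- A fan in `N_ℝ = ℝⁿ`, with respect to the lattice `N = ℤⁿ`: a finite non-empty collection of
strongly convex rational polyhedral cones, closed under taking faces, any two of which meet along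
a common face. -/
structure Fan (n : ℕ) where
  cones : Set (PointedCone ℝ (Fin n → ℝ))
  finite : cones.Finite
  nonempty : cones.Nonempty
  rational : ∀ s ∈ cones, ∃ T : Finset (Fin n → ℤ),
    PointedCone.hull ℝ (realVec '' (T : Set (Fin n → ℤ))) = s
  salient : ∀ s ∈ cones, (s : ConvexCone ℝ (Fin n → ℝ)).Salient
  face_mem : ∀ s ∈ cones, ∀ t : PointedCone ℝ (Fin n → ℝ), t.IsFaceOf s → t ∈ cones
  inter_face : ∀ s ∈ cones, ∀ t ∈ cones, (s ⊓ t).IsFaceOf s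

/-- A complete fan: its cones cover `N_ℝ` (equivalently, the toric variety is complete). -/
structure CompleteFan (n : ℕ) extends Fan n where
  complete : ∀ x : Fin n → ℝ, ∃ s ∈ cones, x ∈ s

namespace Fan

variable {n : ℕ} (F : Fan n)

/-- The set `Σ(1)` of rays; a ray (one-dimensional cone of the fan) is given by its primitive
lattice generator. -/
def Ray : Type :=
  {u : Fin n → ℤ // IsPrimitive u ∧ PointedCone.hull ℝ {realVec u} ∈ F.cones}

/-- The primitive generator `u_ρ` of the ray `ρ`. -/
def gen (ρ : F.Ray) : Fin n → ℤ := ρ.1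

lemma exists_dot_eq_one {u : Fin n → ℤ} (hu : IsPrimitive u) : ∃ b : Fin n → ℤ, ∑ i, u i * b i = 1 := by
  obtain ⟨b, hb⟩ := Finset.gcd_eq_sum_mul Finset.univ u
  exact ⟨b, by rw [← hb]; exact hu⟩

lemma eq_of_hull_eq {u v : Fin n → ℤ} (hu : IsPrimitive u) (hv : IsPrimitive v)
    (h : PointedCone.hull ℝ {realVec u} = PointedCone.hull ℝ {realVec v}) : u = v := by
  have h1 : realVec u ∈ PointedCone.hull ℝ {realVec v} := by
    rw [← h]; exact PointedCone.subset_hull rfl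
  have h2 : realVec v ∈ PointedCone.hull ℝ {realVec u} := by
    rw [h]; exact PointedCone.subset_hull rfl
  obtain ⟨c, hc⟩ := Submodule.mem_span_singleton.1 h1
  obtain ⟨d, hd⟩ := Submodule.mem_span_singleton.1 h2
  have hc' : ∀ i, (c : ℝ) * (v i : ℝ) = u i := fun i => congrFun hc i
  have hd' : ∀ i, (d : ℝ) * (u i : ℝ) = v i := fun i => congrFun hd i
  obtain ⟨a, ha⟩ := exists_dot_eq_one hv
  obtain ⟨b, hb⟩ := exists_dot_eq_one hu
  have ec : (c : ℝ) = ((∑ i, u i * a i : ℤ) : ℝ) := by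
    have : ((∑ i, v i * a i : ℤ) : ℝ) = 1 := by rw [ha]; simp
    push_cast at this ⊢
    rw [← mul_one (c : ℝ), ← this, Finset.mul_sum]
    exact Finset.sum_congr rfl fun i _ => by rw [← hc' i]; ring
  have ed : (d : ℝ) = ((∑ i, v i * b i : ℤ) : ℝ) := by
    have : ((∑ i, u i * b i : ℤ) : ℝ) = 1 := by rw [hb]; simp
    push_cast at this ⊢
    rw [← mul_one (d : ℝ), ← this, Finset.mul_sum]
    exact Finset.sum_congr rfl fun i _ => by rw [← hd' i]; ring
  set p := ∑ i, u i * a i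
  set q := ∑ i, v i * b i
  have hpq : p * q = 1 := by
    have h3 : ∀ i, (p : ℝ) * ((q : ℝ) * (u i : ℝ)) = u i := fun i => by
      rw [← ed, hd' i, ← ec, hc' i]
    have h4 : ∀ i, p * q * u i = u i := fun i => by
      have := h3 i
      rw [← mul_assoc] at this
      exact_mod_cast this
    have : p * q * (∑ i, u i * b i) = ∑ i, u i * b i := by
      rw [Finset.mul_sum]
      exact Finset.sum_congr rfl fun i _ => by rw [← mul_assoc, h4 i]
    simpa [hb] using this
  have hp : 0 ≤ p := by
    have : (0 : ℝ) ≤ (p : ℝ) := by rw [← ec]; exact c.2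
    exact_mod_cast this
  have hp1 : p = 1 := by
    rcases Int.eq_one_or_neg_one_of_mul_eq_one hpq with h | h
    · exact h
    · omega
  funext i
  have := hc' i
  rw [ec, hp1] at this
  exact_mod_cast (by simpa using this.symm)

instance : Finite F.Ray := by
  have := F.finite.to_subtype
  refine Finite.of_injective
    (fun ρ : F.Ray => (⟨PointedCone.hull ℝ {realVec ρ.1}, ρ.2.2⟩ : F.cones)) ?_
  intro ρ τ h
  exact Subtype.ext (eq_of_hull_eq ρ.2.1 τ.2.1 (congrArg Subtype.val h))

instance : Fintype F.Ray := Fintype.ofFinite _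

instance : DecidableEq F.Ray := Classical.decEq _

/-! ## Divisor class group and Cox ring -/

/-- The divisor of a character: `div (χ^m) = ∑_ρ ⟨m, u_ρ⟩ D_ρ`, as a homomorphism from the
character lattice `M = ℤⁿ` to the group `ℤ^{Σ(1)}` of torus-invariant Weil divisors. -/
def divChar : (Fin n → ℤ) →+ (F.Ray → ℤ) where
  toFun m := fun ρ => ∑ i, m i * F.gen ρ i
  map_zero' := by ext ρ; simp
  map_add' m m' := by ext ρ; simp [add_mul, Finset.sum_add_distrib]

/-- The divisor class group of the toric variety: torus-invariant Weil divisors modulo divisors of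
characters. -/
abbrev Cl : Type := (F.Ray → ℤ) ⧸ F.divChar.range

/-- The class `[D_ρ]` of the prime divisor `D_ρ`, which is the degree of `x_ρ`. -/
def rayClass (ρ : F.Ray) : F.Cl := QuotientAddGroup.mk (Pi.single ρ 1)

/-- The degree in `Cl` of the monomial with exponents `D`. -/
def monClass (D : F.Ray →₀ ℕ) : F.Cl := Finsupp.weight F.rayClass D

/-- The degree of `x^D` is the class of the effective divisor `D = ∑ a_ρ D_ρ`. -/
lemma monClass_eq (D : F.Ray →₀ ℕ) :
    F.monClass D = QuotientAddGroup.mk (fun ρ => (D ρ : ℤ)) := by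
  rw [monClass, Finsupp.weight_eq_sum]
  have : (fun ρ => (D ρ : ℤ)) = ∑ ρ, D ρ • (Pi.single ρ 1 : F.Ray → ℤ) := by
    ext τ
    simp [Finset.sum_apply, Pi.single_apply]
  rw [this]
  exact (map_sum (QuotientAddGroup.mk' F.divChar.range) _ _).symm

/-- The underlying ring `S = k[x_ρ | ρ ∈ Σ(1)]` of the Cox ring. -/
abbrev CoxRing (k : Type*) [Field k] : Type _ := MvPolynomial F.Ray k

/-- The graded piece `S_α` of the Cox ring. -/
def piece (k : Type*) [Field k] (α : F.Cl) : Submodule k (F.CoxRing k) :=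
  MvPolynomial.weightedHomogeneousSubmodule k F.rayClass α

lemma mem_piece {k : Type*} [Field k] {α : F.Cl} {f : F.CoxRing k} :
    f ∈ F.piece k α ↔ ∀ D, MvPolynomial.coeff D f ≠ 0 → F.monClass D = α :=
  ⟨fun h _ hD => h hD, fun h _ hD => h _ hD⟩

/-- The group `Aut_gr(S)` of graded `k`-algebra automorphisms of the Cox ring; the product is
composition. -/
def autGr (k : Type*) [Field k] : Subgroup (F.CoxRing k ≃ₐ[k] F.CoxRing k) where
  carrier := {φ | ∀ (α : F.Cl) (f : F.CoxRing k), φ f ∈ F.piece k α ↔ f ∈ F.piece k α}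
  one_mem' _ _ := Iff.rfl
  mul_mem' {φ ψ} hφ hψ α f := (hφ α (ψ f)).trans (hψ α f)
  inv_mem' {φ} hφ α f := by
    rw [← hφ α (φ⁻¹ f)]
    exact iff_of_eq (congrArg (· ∈ F.piece k α) (φ.apply_symm_apply f))

/-- The scaling `x_ρ ↦ c x_ρ` of the Cox ring. -/
def scale {k : Type*} [Field k] (c : k) : F.CoxRing k →ₐ[k] F.CoxRing k :=
  MvPolynomial.aeval fun ρ => c • MvPolynomial.X ρ

lemma scale_monomial {k : Type*} [Field k] (c : k) (D : F.Ray →₀ ℕ) (a : k) :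
    F.scale c (MvPolynomial.monomial D a) = MvPolynomial.monomial D (c ^ D.degree * a) := by
  have h1 : ∏ ρ ∈ D.support, (MvPolynomial.C (c ^ D ρ) : F.CoxRing k) =
      MvPolynomial.C (c ^ D.degree) := by
    rw [← map_prod, Finset.prod_pow_eq_pow_sum, Finsupp.degree_apply]
  rw [scale, MvPolynomial.aeval_monomial, MvPolynomial.monomial_eq, Finsupp.prod, Finsupp.prod]
  simp_rw [smul_pow, MvPolynomial.smul_eq_C_mul]
  rw [Finset.prod_mul_distrib, h1, MvPolynomial.algebraMap_eq, map_mul]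
  ring

lemma coeff_scale {k : Type*} [Field k] (c : k) (f : F.CoxRing k) (D : F.Ray →₀ ℕ) :
    MvPolynomial.coeff D (F.scale c f) = c ^ D.degree * MvPolynomial.coeff D f := by
  classical
  induction f using MvPolynomial.induction_on' with
  | monomial E a =>
    rw [scale_monomial, MvPolynomial.coeff_monomial, MvPolynomial.coeff_monomial]
    split_ifs with h
    · rw [h]
    · simp
  | add p q hp hq => rw [map_add, MvPolynomial.coeff_add, MvPolynomial.coeff_add, hp, hq, mul_add]

lemma scale_scale {k : Type*} [Field k] (c d : k) (f : F.CoxRing k) :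
    F.scale c (F.scale d f) = F.scale (c * d) f := by
  ext D
  simp only [coeff_scale, mul_pow, mul_assoc]

lemma scale_one {k : Type*} [Field k] (f : F.CoxRing k) : F.scale 1 f = f := by
  ext D
  simp [coeff_scale]

/-- The distinguished one-parameter subgroup `λ_g : t ↦ (x_ρ ↦ t⁻¹ x_ρ)` of `Aut_gr(S)`. -/
def distinguished (k : Type*) [Field k] : kˣ →* F.autGr k where
  toFun t := ⟨AlgEquiv.ofAlgHom (F.scale ((t⁻¹ : kˣ) : k)) (F.scale (t : k))
      (AlgHom.ext fun f => by simp [scale_scale, scale_one])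
      (AlgHom.ext fun f => by simp [scale_scale, scale_one]), fun α f => by
    simp only [mem_piece, AlgEquiv.ofAlgHom_apply, coeff_scale]
    simp⟩
  map_one' := by
    ext f
    simp [scale_one]
  map_mul' s t := by
    apply Subtype.ext
    apply AlgEquiv.ext
    intro f
    simp [scale_scale, mul_comm]

/-! ## Monomial bases of the pieces `S_i` -/

/-- The degrees `α_1, …, α_l` of the variables (each listed once). -/
abbrev VarClass : Type := Set.range F.rayClass

/-- The variables of degree `α`: a basis of `S'_α`. -/
abbrev Lin (α : F.VarClass) : Type := {ρ : F.Ray // F.rayClass ρ = α}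

/-- The monomials of degree `α` that are not variables: a basis of `S''_α`. -/
abbrev NonLin (α : F.VarClass) : Type :=
  {D : F.Ray →₀ ℕ // F.monClass D = α ∧ ∀ ρ, D ≠ Finsupp.single ρ 1}

/-- Index set of the monomial basis of `S_α = S'_α ⊕ S''_α`. -/
abbrev Idx (α : F.VarClass) : Type := F.Lin α ⊕ F.NonLin α

/-- The exponent vector of a basis monomial. -/
def expo {α : F.VarClass} : F.Idx α → (F.Ray →₀ ℕ)
  | Sum.inl ρ => Finsupp.single ρ.1 1
  | Sum.inr D => D.1

/-- The matrix of `φ|_{S_α} : S_α → S_α` in the monomial basis; the column of the basis element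
`D` lists the coefficients of `φ(x^D)`. -/
def blockMatrix {k : Type*} [Field k] (φ : F.autGr k) (α : F.VarClass) :
    Matrix (F.Idx α) (F.Idx α) k :=
  Matrix.of fun E D => MvPolynomial.coeff (F.expo E)
    (φ.1 (MvPolynomial.monomial (F.expo D) 1))

lemma monClass_expo {α : F.VarClass} (E : F.Idx α) : F.monClass (F.expo E) = α := by
  rcases E with ρ | D
  · rw [expo, monClass, Finsupp.weight_single, one_smul, ρ.2]
  · exact D.2.1

lemma expo_injective {α : F.VarClass} : Function.Injective (F.expo (α := α)) := by
  rintro (ρ | D) (τ | E) h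
  · exact congrArg Sum.inl (Subtype.ext ((Finsupp.single_left_inj one_ne_zero).1 h))
  · exact absurd h.symm (E.2.2 _)
  · exact absurd h (D.2.2 _)
  · exact congrArg Sum.inr (Subtype.ext h)

lemma exists_expo {α : F.VarClass} {D : F.Ray →₀ ℕ} (hD : F.monClass D = α) :
    ∃ E : F.Idx α, F.expo E = D := by
  by_cases h : ∃ ρ, D = Finsupp.single ρ 1
  · obtain ⟨ρ, rfl⟩ := h
    rw [monClass, Finsupp.weight_single, one_smul] at hD
    exact ⟨Sum.inl ⟨ρ, hD⟩, rfl⟩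
  · exact ⟨Sum.inr ⟨D, hD, fun ρ hρ => h ⟨ρ, hρ⟩⟩, rfl⟩

lemma monomial_mem_piece (k : Type*) [Field k] {α : F.VarClass} (E : F.Idx α) :
    (MvPolynomial.monomial (F.expo E) (1 : k)) ∈ F.piece k α := by
  classical
  rw [mem_piece]
  intro D hD
  rw [MvPolynomial.coeff_monomial] at hD
  have : F.expo E = D := by
    by_contra h
    exact hD (if_neg h)
  rw [← this, monClass_expo]

lemma eq_sum_of_mem_piece {k : Type*} [Field k] {α : F.VarClass} [Fintype (F.Idx α)]
    {f : F.CoxRing k} (hf : f ∈ F.piece k α) :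
    f = ∑ E : F.Idx α, MvPolynomial.coeff (F.expo E) f • MvPolynomial.monomial (F.expo E) 1 := by
  classical
  ext D
  simp only [MvPolynomial.coeff_sum, MvPolynomial.coeff_smul, MvPolynomial.coeff_monomial,
    smul_eq_mul, mul_ite, mul_one, mul_zero]
  by_cases hD : F.monClass D = α
  · obtain ⟨E, rfl⟩ := F.exists_expo hD
    simp [F.expo_injective.eq_iff]
  · have h0 : MvPolynomial.coeff D f = 0 := by
      by_contra h
      exact hD ((F.mem_piece).1 hf D h)
    rw [h0, Finset.sum_eq_zero]
    intro E _
    rw [if_neg]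
    rintro rfl
    exact hD (F.monClass_expo E)

lemma blockMatrix_one (k : Type*) [Field k] (α : F.VarClass) [DecidableEq (F.Idx α)] :
    F.blockMatrix (1 : F.autGr k) α = 1 := by
  classical
  ext E D
  simp only [blockMatrix, Matrix.of_apply, OneMemClass.coe_one, AlgEquiv.one_apply,
    MvPolynomial.coeff_monomial, Matrix.one_apply, F.expo_injective.eq_iff, eq_comm]

lemma blockMatrix_mul {k : Type*} [Field k] (φ ψ : F.autGr k) (α : F.VarClass)
    [Fintype (F.Idx α)] :
    F.blockMatrix (φ * ψ) α = F.blockMatrix φ α * F.blockMatrix ψ α := by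
  ext E D
  have h := F.eq_sum_of_mem_piece ((ψ.2 α _).2 (F.monomial_mem_piece k D))
  have h2 : F.blockMatrix (φ * ψ) α E D =
      MvPolynomial.coeff (F.expo E) (φ.1 (ψ.1 (MvPolynomial.monomial (F.expo D) 1))) := rfl
  rw [h2, h, map_sum, MvPolynomial.coeff_sum, Matrix.mul_apply]
  refine Finset.sum_congr rfl fun K _ => ?_
  rw [map_smul, MvPolynomial.coeff_smul, smul_eq_mul, mul_comm]
  rfl

/-- If a ray generated by a nonzero lattice vector is a cone of the fan, then that vector lies in
the cone generated by the rays of the fan. -/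
lemma mem_of_hull_mem {v : Fin n → ℤ} (hv : v ≠ 0)
    (h : PointedCone.hull ℝ {realVec v} ∈ F.cones) :
    realVec v ∈ PointedCone.hull ℝ (Set.range fun ρ : F.Ray => realVec (F.gen ρ)) := by
  obtain ⟨i, hi⟩ := Function.ne_iff.1 hv
  obtain ⟨u, hu, hu1⟩ := Finset.extract_gcd v ⟨i, Finset.mem_univ i⟩
  set d := Finset.univ.gcd v with hd
  have hd0 : d ≠ 0 := fun h0 => hi (by simpa [h0] using hu i (Finset.mem_univ i))
  have hdn : 0 ≤ d := Int.nonneg_of_normalize_eq_self Finset.normalize_gcd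
  have hdp : (0 : ℝ) < d := by exact_mod_cast lt_of_le_of_ne hdn (Ne.symm hd0)
  have hvu : realVec v = (⟨(d : ℝ), hdp.le⟩ : {c : ℝ // 0 ≤ c}) • realVec u := by
    funext j
    have := hu j (Finset.mem_univ j)
    change (v j : ℝ) = (d : ℝ) * (u j : ℝ)
    exact_mod_cast this
  have huv : realVec u = (⟨(d : ℝ)⁻¹, (inv_pos.2 hdp).le⟩ : {c : ℝ // 0 ≤ c}) • realVec v := by
    funext j
    have := hu j (Finset.mem_univ j)
    change (u j : ℝ) = (d : ℝ)⁻¹ * (v j : ℝ)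
    rw [this]
    push_cast
    field_simp
  have heq : PointedCone.hull ℝ {realVec u} = PointedCone.hull ℝ {realVec v} := by
    apply le_antisymm
    · rw [Submodule.span_le, Set.singleton_subset_iff]
      exact Submodule.mem_span_singleton.2 ⟨_, huv.symm⟩
    · rw [Submodule.span_le, Set.singleton_subset_iff]
      exact Submodule.mem_span_singleton.2 ⟨_, hvu.symm⟩
  rw [hvu]
  exact Submodule.smul_mem _ _ (PointedCone.subset_hull ⟨⟨u, hu1, heq ▸ h⟩, rfl⟩)

/-- Every cone of a fan is generated by rays of the fan. -/
lemma cone_le {s : PointedCone ℝ (Fin n → ℝ)} (hs : s ∈ F.cones) :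
    s ≤ PointedCone.hull ℝ (Set.range fun ρ : F.Ray => realVec (F.gen ρ)) := by
  classical
  obtain ⟨T, hT⟩ := F.rational s hs
  induction hm : T.card using Nat.strong_induction_on generalizing T with
  | _ m ih =>
  by_cases hred : ∃ v ∈ T, realVec v ∈
      PointedCone.hull ℝ (realVec '' ((T.erase v : Finset (Fin n → ℤ)) : Set (Fin n → ℤ)))
  · obtain ⟨v, hvT, hv⟩ := hred
    refine ih _ (by rw [← hm]; exact Finset.card_erase_lt_of_mem hvT) (T.erase v) ?_ rfl
    rw [← hT]
    apply le_antisymm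
    · exact Submodule.span_mono (Set.image_mono (by exact_mod_cast Finset.erase_subset v T))
    · rw [Submodule.span_le]
      rintro _ ⟨w, hw, rfl⟩
      by_cases hwv : w = v
      · rw [hwv]; exact hv
      · exact PointedCone.subset_hull ⟨w, by simpa [hwv] using hw, rfl⟩
  · push Not at hred
    rw [← hT, Submodule.span_le]
    rintro _ ⟨v, hvT, rfl⟩
    have hvT' : v ∈ T := hvT
    have hv0 : v ≠ 0 := by
      rintro rfl
      refine hred 0 hvT ?_
      have : realVec (0 : Fin n → ℤ) = 0 := by funext i; simp [realVec]
      rw [this]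
      exact zero_mem _
    refine F.mem_of_hull_mem hv0 (F.face_mem s hs _ ?_)
    set P := PointedCone.hull ℝ (realVec '' ((T.erase v : Finset (Fin n → ℤ)) : Set (Fin n → ℤ)))
      with hP
    have hPs : P ≤ s := by
      rw [← hT]
      exact Submodule.span_mono (Set.image_mono (by exact_mod_cast Finset.erase_subset v T))
    have hvs : realVec v ∈ s := by rw [← hT]; exact PointedCone.subset_hull ⟨v, hvT, rfl⟩
    have hdec : ∀ x ∈ s, ∃ a : ℝ, 0 ≤ a ∧ ∃ p ∈ P, x = a • realVec v + p := by
      intro x hx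
      have hTi : (T : Set (Fin n → ℤ)) = insert v ((T.erase v : Finset _) : Set (Fin n → ℤ)) := by
        rw [← Finset.coe_insert, Finset.insert_erase hvT']
      rw [← hT, hTi, Set.image_insert_eq] at hx
      obtain ⟨a, p, hp, rfl⟩ := Submodule.mem_span_insert.1 hx
      exact ⟨a, a.2, p, hp, rfl⟩
    have hsal : ∀ x ∈ s, -x ∈ s → x = 0 := fun x hx hnx => by
      by_contra h0
      exact F.salient s hs x hx h0 hnx
    apply PointedCone.IsFaceOf.of_mem_of_add_mem_left
    · rw [Submodule.span_le, Set.singleton_subset_iff]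
      exact hvs
    · intro x y hx hy hxy
      obtain ⟨a, ha, p, hp, rfl⟩ := hdec x hx
      obtain ⟨b, hb, q, hq, rfl⟩ := hdec y hy
      obtain ⟨c, hc⟩ := Submodule.mem_span_singleton.1 hxy
      have hc' : (c : ℝ) • realVec v = a • realVec v + p + (b • realVec v + q) := hc
      have hpq : p + q = ((c : ℝ) - (a + b)) • realVec v := by
        rw [sub_smul, hc', add_smul]; abel
      rcases lt_or_ge 0 ((c : ℝ) - (a + b)) with hpos | hneg
      · exfalso
        refine hred v hvT ?_
        have : realVec v = ((c : ℝ) - (a + b))⁻¹ • (p + q) := by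
          rw [hpq, smul_smul, inv_mul_cancel₀ hpos.ne', one_smul]
        rw [this]
        exact PointedCone.smul_mem P (inv_pos.2 hpos).le (add_mem hp hq)
      · have hnp : -(p + q) ∈ s := by
          rw [hpq, ← neg_smul]
          exact PointedCone.smul_mem s (by linarith) hvs
        have h0 : p = 0 := by
          refine hsal p (hPs hp) ?_
          have : -p = -(p + q) + q := by abel
          rw [this]
          exact add_mem hnp (hPs hq)
        rw [h0, add_zero]
        exact PointedCone.smul_mem _ ha (PointedCone.subset_hull rfl)

end Fan

namespace CompleteFan

variable {n : ℕ} (F : CompleteFan n)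

/-- In a complete fan there is a positive linear relation among the ray generators. -/
lemma exists_pos_relation : ∃ c : F.Ray → ℝ, (∀ ρ, 0 < c ρ) ∧
    ∀ i, ∑ ρ, c ρ * (F.gen ρ i : ℝ) = 0 := by
  have h : ∀ ρ : F.Ray, ∃ d : F.Ray → ℝ, (∀ τ, 0 ≤ d τ) ∧
      ∀ i, ∑ τ, d τ * (F.gen τ i : ℝ) = -(F.gen ρ i : ℝ) := by
    intro ρ
    obtain ⟨s, hs, hx⟩ := F.complete (-realVec (F.gen ρ))
    obtain ⟨d, hd⟩ := (Submodule.mem_span_range_iff_exists_fun _).1 (F.cone_le hs hx)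
    refine ⟨fun τ => d τ, fun τ => (d τ).2, fun i => ?_⟩
    have := congrFun hd i
    rw [Finset.sum_apply] at this
    exact this
  choose d hd0 hd using h
  refine ⟨fun τ => 1 + ∑ ρ, d ρ τ, fun τ => ?_, fun i => ?_⟩
  · have : 0 ≤ ∑ ρ, d ρ τ := Finset.sum_nonneg fun ρ _ => hd0 ρ τ
    linarith
  · simp_rw [add_mul, one_mul, Finset.sum_add_distrib, Finset.sum_mul]
    rw [Finset.sum_comm]
    simp_rw [hd]
    simp

/-- In a complete fan there are only finitely many monomials of a given degree. -/
lemma finite_monomials (α : F.Cl) : {D : F.Ray →₀ ℕ | F.monClass D = α}.Finite := by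
  obtain ⟨c, hc, hrel⟩ := F.exists_pos_relation
  by_cases hne : ∃ D₀, F.monClass D₀ = α
  swap
  · convert Set.finite_empty
    ext D
    exact ⟨fun h => hne ⟨D, h⟩, fun h => h.elim⟩
  obtain ⟨D₀, h₀⟩ := hne
  have key : ∀ D : F.Ray →₀ ℕ, F.monClass D = α →
      ∑ ρ, c ρ * (D ρ : ℝ) = ∑ ρ, c ρ * (D₀ ρ : ℝ) := by
    intro D hD
    rw [← h₀, F.monClass_eq, F.monClass_eq, QuotientAddGroup.eq] at hD
    obtain ⟨m, hm⟩ := hD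
    have hm' : ∀ ρ, (D₀ ρ : ℝ) = D ρ + ∑ i, (m i : ℝ) * (F.gen ρ i : ℝ) := by
      intro ρ
      have h1 : ∑ i, m i * F.gen ρ i = -(D ρ : ℤ) + (D₀ ρ : ℤ) := congrFun hm ρ
      have h2 : (∑ i, (m i : ℝ) * (F.gen ρ i : ℝ)) = -(D ρ : ℝ) + (D₀ ρ : ℝ) := by
        exact_mod_cast h1
      rw [h2]; ring
    have h3 : ∑ ρ, c ρ * ∑ i, (m i : ℝ) * (F.gen ρ i : ℝ) = 0 := by
      simp_rw [Finset.mul_sum]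
      rw [Finset.sum_comm]
      refine Finset.sum_eq_zero fun i _ => ?_
      have : ∀ ρ, c ρ * ((m i : ℝ) * (F.gen ρ i : ℝ)) = m i * (c ρ * (F.gen ρ i : ℝ)) :=
        fun ρ => by ring
      simp_rw [this, ← Finset.mul_sum, hrel, mul_zero]
    simp_rw [hm', mul_add, Finset.sum_add_distrib, h3, add_zero]
  set K := ∑ ρ, c ρ * (D₀ ρ : ℝ)
  refine (Set.finite_Iic (Finsupp.equivFunOnFinite.symm fun ρ => ⌊K / c ρ⌋₊)).subset ?_
  intro D hD ρ
  have h1 : c ρ * (D ρ : ℝ) ≤ K := by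
    rw [← key D hD]
    exact Finset.single_le_sum (f := fun ρ => c ρ * (D ρ : ℝ))
      (fun τ _ => mul_nonneg (hc τ).le (Nat.cast_nonneg _)) (Finset.mem_univ ρ)
  exact Nat.le_floor ((le_div_iff₀ (hc ρ)).2 (by linarith))

instance (α : F.VarClass) : Finite (F.NonLin α) :=
  ((F.finite_monomials α).subset fun _ h => h.1).to_subtype

instance (α : F.VarClass) : Fintype (F.NonLin α) := Fintype.ofFinite _

instance (α : F.VarClass) : Fintype (F.Lin α) := Fintype.ofFinite _

instance : Fintype F.VarClass := Fintype.ofFinite _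

instance (α : F.VarClass) : DecidableEq (F.NonLin α) := Classical.decEq _

instance (α : F.VarClass) : DecidableEq (F.Lin α) := Classical.decEq _

instance : DecidableEq F.VarClass := Classical.decEq _

/-- Index set of the monomial basis of `S_1 ⊕ ⋯ ⊕ S_l`. -/
abbrev Index : Type := (α : F.VarClass) × F.Idx α

/-- The inclusion `Aut_gr(S) → ∏_i End(S_i)`, `φ ↦ (φ|_{S_i})_i`, as a homomorphism to block
diagonal matrices in the monomial basis of `S_1 ⊕ ⋯ ⊕ S_l`. -/
def toMatrix (k : Type*) [Field k] : F.autGr k →* Matrix F.Index F.Index k where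
  toFun φ := Matrix.blockDiagonal' fun α => F.blockMatrix φ α
  map_one' := by
    rw [← Matrix.blockDiagonal'_one]
    exact congrArg _ (funext fun α => F.blockMatrix_one k α)
  map_mul' φ ψ := by
    rw [← Matrix.blockDiagonal'_mul]
    exact congrArg _ (funext fun α => F.blockMatrix_mul φ ψ α)

/-- `Aut_gr(S)` as a group of invertible matrices. -/
def toGL (k : Type*) [Field k] : F.autGr k →* GL F.Index k := (F.toMatrix k).toHomUnits

/-- The matrices determine the automorphism. -/
lemma toGL_injective (k : Type*) [Field k] : Function.Injective (F.toGL k) := by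
  intro φ ψ h
  have h1 : F.toMatrix k φ = F.toMatrix k ψ := congrArg Units.val h
  have h2 : (fun α => F.blockMatrix φ α) = fun α => F.blockMatrix ψ α :=
    Matrix.blockDiagonal'_injective h1
  apply Subtype.ext
  apply AlgEquiv.coe_toAlgHom_injective
  apply MvPolynomial.algHom_ext
  intro ρ
  let α : F.VarClass := ⟨F.rayClass ρ, ρ, rfl⟩
  let D : F.Idx α := Sum.inl ⟨ρ, rfl⟩
  have hX : (MvPolynomial.X ρ : F.CoxRing k) = MvPolynomial.monomial (F.expo D) 1 := rfl
  change φ.1 (MvPolynomial.X ρ) = ψ.1 (MvPolynomial.X ρ)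
  rw [hX, F.eq_sum_of_mem_piece ((φ.2 α _).2 (F.monomial_mem_piece k D)),
    F.eq_sum_of_mem_piece ((ψ.2 α _).2 (F.monomial_mem_piece k D))]
  refine Finset.sum_congr rfl fun E _ => ?_
  have : F.blockMatrix φ α E D = F.blockMatrix ψ α E D := by rw [congrFun h2 α]
  exact congrArg (· • _) this

end CompleteFan

/-! ## Linear algebraic groups

Over an algebraically closed field `k`, linear algebraic groups are taken as Zariski closed
subgroups of `GL ι k`, for a finite type `ι`. -/

section AlgebraicGroups

open Topology

variable {k : Type*} [Field k] {ι : Type*} [Fintype ι] [DecidableEq ι]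

/-- The Zariski topology on `GL ι k`: the subspace topology from the `k`-points of the affine space
of matrices, that is, of the prime spectrum of `k[x_{ij}]`. -/
@[reducible]
def zariski (k : Type*) [Field k] (ι : Type*) [Fintype ι] [DecidableEq ι] :
    TopologicalSpace (GL ι k) :=
  TopologicalSpace.induced
    (fun g => (MvPolynomial.pointToPoint (k := k) (fun p : ι × ι => g.1 p.1 p.2) :
      PrimeSpectrum (MvPolynomial (ι × ι) k)))
    PrimeSpectrum.zariskiTopology

/-- The closed sets are the common zero loci of sets of polynomials in the matrix entries. -/
lemma isClosed_zariski_iff (Z : Set (GL ι k)) : IsClosed[zariski k ι] Z ↔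
    ∃ I : Set (MvPolynomial (ι × ι) k),
      Z = {g | ∀ f ∈ I, MvPolynomial.eval (fun p => g.1 p.1 p.2) f = 0} := by
  have key : ∀ I : Set (MvPolynomial (ι × ι) k),
      (fun g : GL ι k => (MvPolynomial.pointToPoint (k := k) (fun p : ι × ι => g.1 p.1 p.2) :
        PrimeSpectrum (MvPolynomial (ι × ι) k))) ⁻¹' PrimeSpectrum.zeroLocus I =
      {g | ∀ f ∈ I, MvPolynomial.eval (fun p => g.1 p.1 p.2) f = 0} := by
    intro I
    ext g
    simp only [Set.mem_preimage, PrimeSpectrum.mem_zeroLocus, Set.mem_ofPred_eq, Set.subset_def]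
    refine forall₂_congr fun f _ => ?_
    change f ∈ MvPolynomial.vanishingIdeal k {_} ↔ _
    rw [MvPolynomial.mem_vanishingIdeal_singleton_iff, MvPolynomial.aeval_eq_eval]
  rw [isClosed_induced_iff]
  constructor
  · rintro ⟨t, ht, rfl⟩
    obtain ⟨I, rfl⟩ := (PrimeSpectrum.isClosed_iff_zeroLocus t).1 ht
    exact ⟨I, key I⟩
  · rintro ⟨I, rfl⟩
    exact ⟨_, PrimeSpectrum.isClosed_zeroLocus I, key I⟩

/-- A Zariski closed set of invertible matrices. -/
def IsZariskiClosed (Z : Set (GL ι k)) : Prop := @IsClosed _ (zariski k ι) Z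

/-- A connected set of invertible matrices in the Zariski topology. -/
def IsZariskiConnected (Z : Set (GL ι k)) : Prop := @IsConnected _ (zariski k ι) Z

/-- A group of matrices is unipotent if all its elements are. -/
def IsUnipotent (H : Subgroup (GL ι k)) : Prop := ∀ h ∈ H, IsNilpotent (h.1 - 1)

/-- `U` is the unipotent radical of `G`: the largest closed connected normal unipotent subgroup. -/
def IsUnipotentRadical (G U : Subgroup (GL ι k)) : Prop :=
  IsGreatest {H : Subgroup (GL ι k) | H ≤ G ∧ (H.subgroupOf G).Normal ∧
    IsZariskiClosed (H : Set (GL ι k)) ∧ IsZariskiConnected (H : Set (GL ι k)) ∧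
    IsUnipotent H} U

/-- A reductive group: a closed subgroup with trivial unipotent radical. -/
def IsReductive (R : Subgroup (GL ι k)) : Prop :=
  IsZariskiClosed (R : Set (GL ι k)) ∧ IsUnipotentRadical R ⊥

/-- A Levi decomposition `G = R ⋉ U` of a linear algebraic group: `U` is the unipotent radical and
`R` is a reductive subgroup complementary to it. -/
structure IsLeviDecomposition (G R U : Subgroup (GL ι k)) : Prop where
  closed : IsZariskiClosed (G : Set (GL ι k))
  radical : IsUnipotentRadical G U
  reductive : IsReductive R
  inf_eq : R ⊓ U = ⊥
  sup_eq : R ⊔ U = G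

/-- The Lie algebra of a closed subgroup `H` of `GL ι k`, as a space of matrices: the tangent space
at the identity, cut out by the differentials at `1` of the polynomials that vanish on `H`. -/
def lieAlg (H : Subgroup (GL ι k)) : Submodule k (Matrix ι ι k) where
  carrier := {A | ∀ f : MvPolynomial (ι × ι) k,
    (∀ h ∈ H, MvPolynomial.eval (fun p => h.1 p.1 p.2) f = 0) →
      ∑ p : ι × ι, MvPolynomial.eval (fun p => (1 : Matrix ι ι k) p.1 p.2)
        (MvPolynomial.pderiv p f) * A p.1 p.2 = 0}
  zero_mem' f _ := by simp
  add_mem' {A B} hA hB f hf := by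
    simp only [Matrix.add_apply, mul_add, Finset.sum_add_distrib]
    rw [hA f hf, hB f hf, add_zero]
  smul_mem' c A hA f hf := by
    have : ∀ p : ι × ι, MvPolynomial.eval (fun p => (1 : Matrix ι ι k) p.1 p.2)
        (MvPolynomial.pderiv p f) * (c • A) p.1 p.2 =
        c * (MvPolynomial.eval (fun p => (1 : Matrix ι ι k) p.1 p.2)
        (MvPolynomial.pderiv p f) * A p.1 p.2) := fun p => by
      rw [Matrix.smul_apply, smul_eq_mul]; ring
    simp only [this, ← Finset.mul_sum]
    rw [hA f hf, mul_zero]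

/-- The linear map `A ↦ g A g⁻¹` on matrices, the derivative of conjugation by `g`. -/
def conj (g : GL ι k) : Module.End k (Matrix ι ι k) :=
  (LinearMap.mulLeft k g.1).comp (LinearMap.mulRight k (g⁻¹).1)

/-- The weight space of weight `i` in `L` for `a : kˣ → End V`:
the vectors `v ∈ L` with `a(t) v = tⁱ v` for all `t`. -/
def weightSpace {V : Type*} [AddCommGroup V] [Module k V] (a : kˣ → Module.End k V)
    (L : Submodule k V) (i : ℤ) : Submodule k V where
  carrier := {v | v ∈ L ∧ ∀ t : kˣ, a t v = ((t ^ i : kˣ) : k) • v}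
  zero_mem' := ⟨zero_mem _, by simp⟩
  add_mem' {v w} hv hw := ⟨add_mem hv.1 hw.1, fun t => by rw [map_add, hv.2, hw.2, smul_add]⟩
  smul_mem' c v hv := ⟨L.smul_mem c hv.1, fun t => by rw [map_smul, hv.2, smul_comm]⟩

/-- `L` is the sum of its weight spaces, and all its weights are positive. -/
def IsPositivelyGraded {V : Type*} [AddCommGroup V] [Module k V] (a : kˣ → Module.End k V)
    (L : Submodule k V) : Prop :=
  L = ⨆ i : ℤ, weightSpace a L i ∧ ∀ i : ℤ, weightSpace a L i ≠ ⊥ → 0 < i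

/-- A homomorphism `𝔾_m → GL ι` is a one-parameter subgroup if it is a morphism of varieties: its
entries are Laurent polynomials in `t`. -/
def IsOneParameterSubgroup (lam : kˣ →* GL ι k) : Prop :=
  ∃ P : Matrix ι ι (LaurentPolynomial k), ∀ (t : kˣ) (i j : ι),
    (lam t).1 i j = LaurentPolynomial.eval₂ (RingHom.id k) t (P i j)

/-- `lam` is a one-parameter subgroup of the centre of `R`. -/
def IsCentralOneParameterSubgroup (lam : kˣ →* GL ι k) (R : Subgroup (GL ι k)) : Prop :=
  IsOneParameterSubgroup lam ∧ ∀ t, lam t ∈ R ∧ ∀ r ∈ R, r * lam t = lam t * r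

/-- `G` has a graded unipotent radical: for some Levi decomposition `G = R ⋉ U` there is a central
one-parameter subgroup `lam` of `R` such that the action `u ↦ lam(t) u lam(t)⁻¹` on `U` has only
positive weights on `Lie U`. -/
def HasGradedUnipotentRadical (G : Subgroup (GL ι k)) : Prop :=
  ∃ (R U : Subgroup (GL ι k)) (lam : kˣ →* GL ι k), IsLeviDecomposition G R U ∧
    IsCentralOneParameterSubgroup lam R ∧
    IsPositivelyGraded (fun t => conj (lam t)) (lieAlg U)

end AlgebraicGroups

/-- A square matrix is lower triangular with ones on the diagonal, for the linear order `o` on its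
index set. -/
def IsLowerUnitriangular {k : Type*} [Field k] {m : Type*} (o : LinearOrder m)
    (C : Matrix m m k) : Prop :=
  (∀ i j, o.lt i j → C i j = 0) ∧ ∀ i, C i i = 1

end ToricCox

end

noncomputable section

/-! ### Derivatives of polynomials under a rescaling of the variables. -/

namespace MvPolynomial

variable {k σ : Type*} [Field k]

/-! Let `d` be the total degree of a basis monomial. Completeness of the fan makes the degree of
every variable nonzero (`ne_zero_of_monClass`), so a graded automorphism sends variables to
polynomials without constant term and preserves the powers of the ideal of variables. Its matrix is
therefore block lower triangular for `d`, while the inverse of `λ_g` is the diagonal group `t ^ d`.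

Conjugation by `t ^ d` multiplies the entry `(i, j)` by `t ^ (d i - d j)`. On block lower triangular
matrices this extends to `t = 0`, with limit the block diagonal part. Since G is Zariski closed
(`isZariskiClosed_range_toGL`), the limit stays in G. Taking limits is thus a homomorphic retraction
`gr` of G onto the block diagonal subgroup R, which commutes with `t ^ d`; its kernel U is a
complement. U is unipotent because it differs from 1 only strictly below the blocks, it is connected
because the contracting curves join its elements to 1, and Lie U lives in entries with `d i > d j`,
which have positive weight.

It remains to see that R has no nontrivial normal unipotent subgroup
(`eq_bot_of_normal_isUnipotent`). This makes R reductive and U the unipotent radical, since `gr`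
carries normal unipotent subgroups of G to such subgroups of R. An element of R is determined by its
action on the spaces `S_i'`, and R contains all transvections there. If `1 + A` is such an action
for an element of a normal unipotent subgroup, its product with a conjugate by a transvection is
again unipotent; the trace of that product forces every off-diagonal entry of `A` to vanish
(`Matrix.eq_zero_of_isNilpotent_transvection`).

Because R is seen on the `S_i'`, U consists of the automorphisms with identity linear parts, which
gives the matrix description. -/

lemma eval_rescale (c x : σ → k) (f : MvPolynomial σ k) :
    eval x (aeval (fun p => C (c p) * X p) f : MvPolynomial σ k) =
      eval (fun p => c p * x p) f := by
  induction f using MvPolynomial.induction_on with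
  | C a => simp
  | add f g hf hg => simp only [map_add, hf, hg]
  | mul_X f p hf => simp only [map_mul, hf, aeval_X, eval_C, eval_X]

/-- Chain rule. Since the rescaling fixes `x`, both derivatives are evaluated at the same point;
below, `x` is the identity matrix. -/
lemma eval_pderiv_rescale (c x : σ → k) (hx : ∀ p, c p * x p = x p) (q : σ)
    (f : MvPolynomial σ k) :
    eval x (pderiv q (aeval (fun p => C (c p) * X p) f : MvPolynomial σ k)) =
      c q * eval x (pderiv q f) := by
  classical
  induction f using MvPolynomial.induction_on with
  | C a => simp
  | add f g hf hg => simp only [map_add, hf, hg, mul_add]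
  | mul_X f p hf =>
    simp only [map_mul, aeval_X, pderiv_mul, map_add, hf, eval_rescale, eval_C, eval_X, pderiv_C,
      hx]
    rcases eq_or_ne p q with rfl | h
    · simp
      ring
    · simp [pderiv_X_of_ne h, mul_assoc]

end MvPolynomial

/-! ### Closed matrix groups contracted by a diagonal one-parameter group. -/

namespace ToricCox

section Levi

variable {k : Type*} [Field k] {ι : Type*}

/-- The block diagonal part of a matrix for the grading `d` of the index set. -/
def blockPart (d : ι → ℕ) (M : Matrix ι ι k) : Matrix ι ι k :=
  Matrix.of fun i j => if d i = d j then M i j else 0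

lemma blockPart_apply (d : ι → ℕ) (M : Matrix ι ι k) (i j : ι) :
    blockPart d M i j = if d i = d j then M i j else 0 := rfl

/-- The entry `(i, j)` is scaled by `t ^ (d i - d j)`. -/
def curve (d : ι → ℕ) (M : Matrix ι ι k) (t : k) : Matrix ι ι k :=
  Matrix.of fun i j => t ^ (d i - d j) * M i j

lemma curve_one (d : ι → ℕ) (M : Matrix ι ι k) : curve d M 1 = M := by
  ext i j
  simp [curve]

/-- A polynomial in the entries of `curve d M t` is a polynomial in `t`. -/
def curvePoly (d : ι → ℕ) (M : Matrix ι ι k) (f : MvPolynomial (ι × ι) k) : Polynomial k :=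
  MvPolynomial.aeval
    (fun p : ι × ι => (Polynomial.X : Polynomial k) ^ (d p.1 - d p.2) * Polynomial.C (M p.1 p.2)) f

lemma eval_curvePoly (d : ι → ℕ) (M : Matrix ι ι k) (f : MvPolynomial (ι × ι) k) (t : k) :
    (curvePoly d M f).eval t = MvPolynomial.eval (fun p => curve d M t p.1 p.2) f := by
  induction f using MvPolynomial.induction_on with
  | C a => simp [curvePoly]
  | add f g hf hg => simp only [curvePoly, map_add, Polynomial.eval_add] at *; rw [hf, hg]
  | mul_X f p hf =>
    simp only [curvePoly, map_mul, Polynomial.eval_mul] at *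
    rw [hf]
    simp [curve, mul_comm (M p.1 p.2)]

variable [Fintype ι] [DecidableEq ι]

/-- Matrices that are block lower triangular for the grading `d` of the index set. -/
def lowerSubalgebra (k : Type*) [Field k] (d : ι → ℕ) : Subalgebra k (Matrix ι ι k) where
  carrier := {M | ∀ i j, d i < d j → M i j = 0}
  mul_mem' {M N} hM hN i j h := by
    rw [Matrix.mul_apply]
    refine Finset.sum_eq_zero fun l _ => ?_
    rcases lt_or_ge (d i) (d l) with h1 | h1
    · rw [hM i l h1, zero_mul]
    · rw [hN l j (h1.trans_lt h), mul_zero]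
  add_mem' {M N} hM hN i j h := by rw [Matrix.add_apply, hM i j h, hN i j h, add_zero]
  algebraMap_mem' c i j h := by
    rw [Matrix.algebraMap_matrix_apply, if_neg (by rintro rfl; exact h.ne rfl)]

lemma blockPart_algebraMap (d : ι → ℕ) (c : k) :
    blockPart d (algebraMap k (Matrix ι ι k) c) = algebraMap k (Matrix ι ι k) c := by
  ext i j
  rw [blockPart_apply, Matrix.algebraMap_matrix_apply]
  split_ifs with h1 h2 <;> simp_all

/-- Taking the block diagonal part is multiplicative on block lower triangular matrices. -/
def blockPartHom (k : Type*) [Field k] (d : ι → ℕ) :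
    lowerSubalgebra k d →ₐ[k] Matrix ι ι k where
  toFun M := blockPart d M.1
  map_one' := by simpa using blockPart_algebraMap d (1 : k)
  map_zero' := by simpa using blockPart_algebraMap d (0 : k)
  map_add' M N := by
    ext i j
    simp only [blockPart_apply, Matrix.add_apply, Subalgebra.coe_add]
    split_ifs <;> simp
  map_mul' M N := by
    ext i j
    simp only [blockPart_apply, Matrix.mul_apply, Subalgebra.coe_mul]
    split_ifs with h
    · refine Finset.sum_congr rfl fun l _ => ?_
      -- An index `l` outside the common block of `i` and `j` contributes nothing: one of the two
      -- factors lies above the block diagonal.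
      rcases lt_trichotomy (d i) (d l) with h1 | h1 | h1
      · rw [M.2 i l h1, zero_mul, if_neg h1.ne, zero_mul]
      · rw [if_pos h1, if_pos (h1 ▸ h)]
      · rw [N.2 l j (h ▸ h1), mul_zero, if_neg h1.ne', zero_mul]
    · refine (Finset.sum_eq_zero fun l _ => ?_).symm
      split_ifs <;> simp_all
  commutes' c := blockPart_algebraMap d c

/-- A closed group of block lower triangular matrices that contains
the one-parameter group of the diagonal matrices `t ^ d`. -/
structure IsContracted (G : Subgroup (GL ι k)) (d : ι → ℕ) (lam : kˣ →* GL ι k) : Prop where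
  closed : IsZariskiClosed (G : Set (GL ι k))
  lower : ∀ g ∈ G, g.1 ∈ lowerSubalgebra k d
  lam_eq : ∀ t, (lam t).1 = Matrix.diagonal fun i => (t : k) ^ d i
  lam_mem : ∀ t, lam t ∈ G

/-- The truncated exponent is also 0 when `d i < d j`, but there the entry of a block lower
triangular matrix vanishes. -/
lemma curve_zero {d : ι → ℕ} {M : Matrix ι ι k} (hM : M ∈ lowerSubalgebra k d) :
    curve d M 0 = blockPart d M := by
  ext i j
  rw [blockPart_apply, curve, Matrix.of_apply]
  rcases lt_trichotomy (d i) (d j) with h | h | h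
  · rw [hM i j h, mul_zero, if_neg h.ne]
  · rw [if_pos h, h, Nat.sub_self, pow_zero, one_mul]
  · rw [if_neg h.ne', zero_pow (Nat.sub_ne_zero_of_lt h), zero_mul]

namespace IsContracted

variable {G : Subgroup (GL ι k)} {d : ι → ℕ} {lam : kˣ →* GL ι k}

lemma conj_lam_apply (h : IsContracted G d lam) (t : kˣ) (M : Matrix ι ι k) (i j : ι) :
    conj (lam t) M i j = (t : k) ^ d i * M i j * ((t : k) ^ d j)⁻¹ := by
  have h1 : ((lam t)⁻¹).1 = Matrix.diagonal fun i => ((t⁻¹ : kˣ) : k) ^ d i := by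
    rw [← map_inv, h.lam_eq]
  change ((lam t).1 * (M * ((lam t)⁻¹).1)) i j = _
  rw [h1, h.lam_eq, Matrix.diagonal_mul, Matrix.mul_diagonal, Units.val_inv_eq_inv_val, inv_pow,
    mul_assoc]

lemma conj_lam (h : IsContracted G d lam) (t : kˣ) {M : Matrix ι ι k}
    (hM : M ∈ lowerSubalgebra k d) : conj (lam t) M = curve d M t := by
  ext i j
  rw [h.conj_lam_apply, curve, Matrix.of_apply]
  rcases lt_or_ge (d i) (d j) with h1 | h1
  · rw [hM i j h1, mul_zero, mul_zero, zero_mul]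
  · have : (t : k) ^ d j ≠ 0 := pow_ne_zero _ t.ne_zero
    rw [pow_sub₀ _ t.ne_zero h1]
    ring

/-- Along the curve, each equation of G becomes a polynomial in `t`. It vanishes for all `t ≠ 0`,
where the curve is conjugation by an element of G, hence identically, so the point at `t = 0` also
lies in G once it is invertible. -/
lemma curve_mem_of_isUnit [Infinite k] (h : IsContracted G d lam) {g : GL ι k} (hg : g ∈ G)
    {t : k} (hu : IsUnit (curve d g.1 t)) : ∃ g' ∈ G, g'.1 = curve d g.1 t := by
  obtain ⟨g', hg'⟩ := hu
  refine ⟨g', ?_, hg'⟩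
  obtain ⟨I, hI⟩ := (isClosed_zariski_iff _).1 h.closed
  have hmem : ∀ x, x ∈ G ↔ ∀ f ∈ I, MvPolynomial.eval (fun p => x.1 p.1 p.2) f = 0 := by
    intro x
    rw [← SetLike.mem_coe, hI]
    rfl
  rw [hmem]
  intro f hf
  rw [hg', ← eval_curvePoly]
  have hroot : ∀ t : kˣ, (curvePoly d g.1 f).eval (t : k) = 0 := by
    intro t
    rw [eval_curvePoly, ← h.conj_lam t (h.lower g hg)]
    exact (hmem (lam t * (g * (lam t)⁻¹))).1
      (mul_mem (h.lam_mem t) (mul_mem hg (inv_mem (h.lam_mem t)))) f hf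
  have : curvePoly d g.1 f = 0 := by
    refine Polynomial.eq_zero_of_infinite_isRoot _ (Set.Infinite.mono (s := {0}ᶜ) ?_ ?_)
    · intro t ht
      exact hroot (Units.mk0 t ht)
    · exact (Set.finite_singleton (0 : k)).infinite_compl
  rw [this, Polynomial.eval_zero]

/-- The homomorphism onto the block diagonal parts. -/
def gr (h : IsContracted G d lam) : G →* GL ι k :=
  ((blockPartHom k d : lowerSubalgebra k d →* Matrix ι ι k).comp
    { toFun := fun g => (⟨g.1.1, h.lower g.1 g.2⟩ : lowerSubalgebra k d)
      map_one' := rfl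
      map_mul' := fun _ _ => rfl }).toHomUnits

lemma gr_val (h : IsContracted G d lam) (g : G) : (h.gr g).1 = blockPart d g.1.1 := rfl

/-- The block diagonal part is the value at `t = 0` of the contracting curve. -/
lemma gr_mem [Infinite k] (h : IsContracted G d lam) (g : G) : h.gr g ∈ G := by
  have h0 := curve_zero (h.lower g.1 g.2)
  obtain ⟨g', hg', e⟩ := h.curve_mem_of_isUnit g.2 (t := 0)
    (by rw [h0, ← h.gr_val]; exact (h.gr g).isUnit)
  rw [h0, ← h.gr_val] at e
  rwa [← Units.ext e]

/-- The subgroup of elements with trivial block diagonal part. -/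
def unip (h : IsContracted G d lam) : Subgroup (GL ι k) := h.gr.ker.map G.subtype

/-- The subgroup of block diagonal elements. -/
def levi (h : IsContracted G d lam) : Subgroup (GL ι k) := (h.gr.eqLocus G.subtype).map G.subtype

lemma mem_unip (h : IsContracted G d lam) {g : GL ι k} :
    g ∈ h.unip ↔ g ∈ G ∧ ∀ i j, d i ≤ d j → g.1 i j = (1 : Matrix ι ι k) i j := by
  have key : ∀ hg : g ∈ G, h.gr ⟨g, hg⟩ = 1 ↔
      ∀ i j, d i ≤ d j → g.1 i j = (1 : Matrix ι ι k) i j := by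
    intro hg
    rw [Units.ext_iff, h.gr_val, ← Matrix.ext_iff]
    refine forall₂_congr fun i j => ?_
    rw [blockPart_apply]
    rcases lt_trichotomy (d i) (d j) with h1 | h1 | h1
    · have hij : i ≠ j := by rintro rfl; exact h1.ne rfl
      simp [h.lower g hg i j h1, Matrix.one_apply_ne hij]
    · simp [h1]
    · have hij : i ≠ j := by rintro rfl; exact h1.ne rfl
      simp [h1.ne', h1.not_ge, Matrix.one_apply_ne hij]
  rw [unip, Subgroup.mem_map]
  constructor
  · rintro ⟨g, hg, rfl⟩
    exact ⟨g.2, (key g.2).1 hg⟩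
  · rintro ⟨hg, h1⟩
    exact ⟨⟨g, hg⟩, (key hg).2 h1, rfl⟩

lemma mem_levi (h : IsContracted G d lam) {g : GL ι k} :
    g ∈ h.levi ↔ g ∈ G ∧ ∀ i j, d i ≠ d j → g.1 i j = 0 := by
  have key : ∀ hg : g ∈ G, h.gr ⟨g, hg⟩ = g ↔ ∀ i j, d i ≠ d j → g.1 i j = 0 := by
    intro hg
    rw [Units.ext_iff, h.gr_val, ← Matrix.ext_iff]
    refine forall₂_congr fun i j => ?_
    rw [blockPart_apply]
    split_ifs with h1 <;> simp [h1, eq_comm]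
  rw [levi, Subgroup.mem_map]
  constructor
  · rintro ⟨g, hg, rfl⟩
    exact ⟨g.2, (key g.2).1 hg⟩
  · rintro ⟨hg, h1⟩
    exact ⟨⟨g, hg⟩, (key hg).2 h1, rfl⟩

lemma unip_le (h : IsContracted G d lam) : h.unip ≤ G := fun _ hg => (h.mem_unip.1 hg).1

lemma levi_le (h : IsContracted G d lam) : h.levi ≤ G := fun _ hg => (h.mem_levi.1 hg).1

lemma gr_mem_levi [Infinite k] (h : IsContracted G d lam) (g : G) : h.gr g ∈ h.levi := by
  refine h.mem_levi.2 ⟨h.gr_mem g, fun i j hij => ?_⟩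
  rw [h.gr_val, blockPart_apply, if_neg hij]

lemma gr_of_mem_levi (h : IsContracted G d lam) {g : GL ι k} (hg : g ∈ h.levi) :
    h.gr ⟨g, h.levi_le hg⟩ = g := by
  obtain ⟨g, hg, rfl⟩ := hg
  exact hg

lemma inf_eq (h : IsContracted G d lam) : h.levi ⊓ h.unip = ⊥ := by
  rw [eq_bot_iff]
  rintro _ ⟨hg, g, hg', rfl⟩
  have h1 := h.gr_of_mem_levi hg
  exact h1.symm.trans hg'

lemma sup_eq [Infinite k] (h : IsContracted G d lam) : h.levi ⊔ h.unip = G := by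
  refine le_antisymm (sup_le h.levi_le h.unip_le) fun g hg => ?_
  have hr := h.gr_mem_levi ⟨g, hg⟩
  have h1 : h.gr ⟨g, hg⟩ * ((h.gr ⟨g, hg⟩)⁻¹ * g) = g := mul_inv_cancel_left _ _
  rw [← h1]
  -- With `r = gr g`, the factor `r⁻¹ g` lies in the kernel because `gr` fixes `r`.
  refine Subgroup.mul_mem_sup hr ⟨⟨h.gr ⟨g, hg⟩, h.gr_mem _⟩⁻¹ * ⟨g, hg⟩, ?_, rfl⟩
  have h2 : h.gr ⟨h.gr ⟨g, hg⟩, h.gr_mem _⟩ = h.gr ⟨g, hg⟩ := h.gr_of_mem_levi hr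
  change h.gr _ = 1
  rw [map_mul, map_inv, h2, inv_mul_cancel]

lemma unip_normal (h : IsContracted G d lam) : (h.unip.subgroupOf G).Normal := by
  have : h.unip.subgroupOf G = h.gr.ker :=
    Subgroup.comap_map_eq_self_of_injective G.subtype_injective _
  rw [this]
  infer_instance

lemma isZariskiClosed_inter_linear (h : IsContracted G d lam) (N : Subgroup (GL ι k))
    (P : ι → ι → Prop) (M : Matrix ι ι k)
    (hN : ∀ g, g ∈ N ↔ g ∈ G ∧ ∀ i j, P i j → g.1 i j = M i j) :
    IsZariskiClosed (N : Set (GL ι k)) := by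
  obtain ⟨I, hI⟩ := (isClosed_zariski_iff _).1 h.closed
  refine (isClosed_zariski_iff _).2
    ⟨I ∪ {f | ∃ i j, P i j ∧ f = MvPolynomial.X (i, j) - MvPolynomial.C (M i j)}, ?_⟩
  ext g
  have hg : g ∈ G ↔ ∀ f ∈ I, MvPolynomial.eval (fun p => g.1 p.1 p.2) f = 0 := by
    rw [← SetLike.mem_coe, hI]
    rfl
  rw [SetLike.mem_coe, hN, hg]
  constructor
  · rintro ⟨h1, h2⟩ f (hf | ⟨i, j, hij, rfl⟩)
    · exact h1 f hf
    · simp [h2 i j hij]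
  · intro h1
    refine ⟨fun f hf => h1 f (Or.inl hf), fun i j hij => ?_⟩
    have := h1 _ (Or.inr ⟨i, j, hij, rfl⟩)
    simpa [sub_eq_zero] using this

lemma unip_closed (h : IsContracted G d lam) : IsZariskiClosed (h.unip : Set (GL ι k)) :=
  h.isZariskiClosed_inter_linear _ (fun i j => d i ≤ d j) 1 fun _ => h.mem_unip

lemma levi_closed (h : IsContracted G d lam) : IsZariskiClosed (h.levi : Set (GL ι k)) :=
  h.isZariskiClosed_inter_linear _ (fun i j => d i ≠ d j) 0 fun _ => h.mem_levi

lemma unip_isUnipotent (h : IsContracted G d lam) : IsUnipotent h.unip := by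
  intro g hg
  have hN : ∀ i j, d i ≤ d j → (g.1 - 1) i j = 0 := fun i j hij => by
    rw [Matrix.sub_apply, (h.mem_unip.1 hg).2 i j hij, sub_self]
  -- `g - 1` raises `d` by at least 1, so its `m`-th power raises `d` by at least `m`; it vanishes
  -- once `m` exceeds the largest value of `d`.
  have hpow : ∀ m i j, d i < d j + m → ((g.1 - 1) ^ m) i j = 0 := by
    intro m
    induction m with
    | zero =>
      intro i j hij
      rw [pow_zero, Matrix.one_apply_ne]
      rintro rfl
      omega
    | succ m ih =>
      intro i j hij
      rw [pow_succ, Matrix.mul_apply]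
      refine Finset.sum_eq_zero fun l _ => ?_
      rcases le_or_gt (d l) (d j) with h1 | h1
      · rw [hN l j h1, mul_zero]
      · rw [ih i l (by omega), zero_mul]
  refine ⟨Finset.univ.sup d + 1, ?_⟩
  ext i j
  refine hpow _ i j ?_
  have := Finset.le_sup (f := d) (Finset.mem_univ i)
  omega

lemma curve_mem_unip [Infinite k] (h : IsContracted G d lam) {g : GL ι k} (hg : g ∈ h.unip)
    (t : k) : ∃ g' ∈ h.unip, g'.1 = curve d g.1 t := by
  have hgG := h.unip_le hg
  have hu : IsUnit (curve d g.1 t) := by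
    rcases eq_or_ne t 0 with rfl | ht
    · rw [curve_zero (h.lower g hgG), ← h.gr_val ⟨g, hgG⟩]
      exact (h.gr ⟨g, hgG⟩).isUnit
    · have := h.conj_lam (Units.mk0 t ht) (h.lower g hgG)
      rw [Units.val_mk0] at this
      rw [← this]
      exact (lam (Units.mk0 t ht) * (g * (lam (Units.mk0 t ht))⁻¹)).isUnit
  obtain ⟨g', hg', e⟩ := h.curve_mem_of_isUnit hgG hu
  refine ⟨g', h.mem_unip.2 ⟨hg', fun i j hij => ?_⟩, e⟩
  rw [e, curve, Matrix.of_apply, (h.mem_unip.1 hg).2 i j hij, Nat.sub_eq_zero_of_le hij, pow_zero,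
    one_mul]

/-- The curve is the image of an affine line, hence irreducible: if it lies in a union of two closed
sets, a product of two polynomials in `t` vanishes identically, so one factor does. -/
lemma curve_isPreconnected [Infinite k] (d : ι → ℕ) (M : Matrix ι ι k)
    (hM : ∀ t, IsUnit (curve d M t)) :
    @IsPreconnected _ (zariski k ι) {g : GL ι k | ∃ t, g.1 = curve d M t} := by
  let := zariski k ι
  apply IsPreirreducible.isPreconnected
  rw [isPreirreducible_iff_isClosed_union_isClosed]
  intro Z W hZ hW hZW
  by_contra! hcon
  simp only [Set.not_subset] at hcon
  obtain ⟨⟨g, ⟨s, hs⟩, hgZ⟩, ⟨g', ⟨s', hs'⟩, hgW⟩⟩ := hcon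
  obtain ⟨I, rfl⟩ := (isClosed_zariski_iff _).1 hZ
  obtain ⟨J, rfl⟩ := (isClosed_zariski_iff _).1 hW
  simp only [Set.mem_ofPred_eq, not_forall] at hgZ hgW
  obtain ⟨f, hf, hf0⟩ := hgZ
  obtain ⟨f', hf', hf0'⟩ := hgW
  rw [hs, ← eval_curvePoly] at hf0
  rw [hs', ← eval_curvePoly] at hf0'
  have hprod : curvePoly d M f * curvePoly d M f' = 0 := by
    refine Polynomial.funext fun t => ?_
    rw [Polynomial.eval_mul, Polynomial.eval_zero, mul_eq_zero, eval_curvePoly, eval_curvePoly]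
    obtain ⟨x, hx⟩ := hM t
    rcases hZW ⟨t, hx⟩ with h1 | h1
    · left; rw [← hx]; exact h1 f hf
    · right; rw [← hx]; exact h1 f' hf'
  rcases mul_eq_zero.1 hprod with h0 | h0
  · exact hf0 (by rw [h0, Polynomial.eval_zero])
  · exact hf0' (by rw [h0, Polynomial.eval_zero])

/-- Each `g` in U is joined to 1 inside U by its contracting curve, from `t = 1` to `t = 0`. -/
lemma unip_connected [Infinite k] (h : IsContracted G d lam) :
    IsZariskiConnected (h.unip : Set (GL ι k)) := by
  let := zariski k ι
  refine ⟨⟨1, one_mem _⟩, isPreconnected_of_forall 1 fun g hg => ?_⟩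
  refine ⟨{x | ∃ t, x.1 = curve d g.1 t}, ?_, ⟨0, ?_⟩, ⟨1, (curve_one d g.1).symm⟩,
    curve_isPreconnected d g.1 fun t => ?_⟩
  · rintro x ⟨t, ht⟩
    obtain ⟨y, hy, e⟩ := h.curve_mem_unip hg t
    rwa [← Units.ext (e.trans ht.symm)]
  · rw [curve_zero (h.lower g (h.unip_le hg))]
    obtain ⟨g, hg, rfl⟩ := hg
    exact (congrArg Units.val hg).symm
  · obtain ⟨y, -, e⟩ := h.curve_mem_unip hg t
    rw [← e]
    exact y.isUnit

/-- The image under `gr` of a normal unipotent subgroup of G is unipotent, and normal in the Levi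
subgroup because `gr` retracts G onto it. By `hred` the image is trivial, so the subgroup lies in
the kernel. -/
lemma isUnipotentRadical_unip [Infinite k] (h : IsContracted G d lam)
    (hred : ∀ N : Subgroup (GL ι k), N ≤ h.levi → (N.subgroupOf h.levi).Normal → IsUnipotent N →
      N = ⊥) : IsUnipotentRadical G h.unip := by
  refine ⟨⟨h.unip_le, h.unip_normal, h.unip_closed, h.unip_connected, h.unip_isUnipotent⟩, ?_⟩
  rintro H ⟨hHG, hn, -, -, hu⟩ g hg
  have hN : (H.subgroupOf G).map h.gr = ⊥ := by
    refine hred _ ?_ ⟨?_⟩ ?_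
    · rintro _ ⟨x, -, rfl⟩
      exact h.gr_mem_levi x
    · intro x hxN r
      obtain ⟨y, hy, hyx⟩ := Subgroup.mem_map.1 (Subgroup.mem_subgroupOf.1 hxN)
      have hr := h.gr_of_mem_levi r.2
      generalize (⟨r.1, h.levi_le r.2⟩ : G) = s at hr
      refine Subgroup.mem_subgroupOf.2 (Subgroup.mem_map.2 ⟨_, hn.conj_mem y hy s, ?_⟩)
      rw [map_mul, map_mul, map_inv, hr, hyx]
      rfl
    · rintro _ ⟨x, hx, rfl⟩
      obtain ⟨m, hm⟩ := hu x.1 hx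
      -- Nilpotency of `x - 1` is read inside the subalgebra, where the block diagonal part is an
      -- algebra homomorphism.
      let y : lowerSubalgebra k d := ⟨x.1.1, h.lower x.1 x.2⟩
      have hy : IsNilpotent (y - 1) := ⟨m, Subtype.ext hm⟩
      have := hy.map (blockPartHom k d)
      rwa [map_sub, map_one] at this
  refine ⟨⟨g, hHG hg⟩, ?_, rfl⟩
  exact (Subgroup.eq_bot_iff_forall _).1 hN _ ⟨⟨g, hHG hg⟩, hg, rfl⟩

lemma isReductive_levi (h : IsContracted G d lam)
    (hred : ∀ N : Subgroup (GL ι k), N ≤ h.levi → (N.subgroupOf h.levi).Normal → IsUnipotent N →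
      N = ⊥) : IsReductive h.levi := by
  refine ⟨h.levi_closed, ⟨bot_le, ?_, ?_, ?_, ?_⟩, ?_⟩
  · rw [Subgroup.bot_subgroupOf]
    infer_instance
  · refine h.isZariskiClosed_inter_linear _ (fun _ _ => True) 1 fun g => ?_
    rw [Subgroup.mem_bot]
    constructor
    · rintro rfl
      exact ⟨one_mem _, fun _ _ _ => rfl⟩
    · rintro ⟨-, h1⟩
      exact Units.ext (Matrix.ext fun i j => h1 i j trivial)
  · let := zariski k ι
    rw [IsZariskiConnected, Subgroup.coe_bot]
    exact isConnected_singleton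
  · intro g hg
    rw [Subgroup.mem_bot.1 hg, Units.val_one, sub_self]
    exact IsNilpotent.zero
  · rintro H ⟨h1, h2, -, -, h3⟩
    exact (hred H h1 h2 h3).le

lemma isLeviDecomposition [Infinite k] (h : IsContracted G d lam)
    (hred : ∀ N : Subgroup (GL ι k), N ≤ h.levi → (N.subgroupOf h.levi).Normal → IsUnipotent N →
      N = ⊥) : IsLeviDecomposition G h.levi h.unip :=
  ⟨h.closed, h.isUnipotentRadical_unip hred, h.isReductive_levi hred, h.inf_eq, h.sup_eq⟩

lemma lam_mem_levi (h : IsContracted G d lam) (t : kˣ) : lam t ∈ h.levi := by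
  refine h.mem_levi.2 ⟨h.lam_mem t, fun i j hij => ?_⟩
  rw [h.lam_eq, Matrix.diagonal_apply_ne]
  rintro rfl
  exact hij rfl

lemma lam_comm (h : IsContracted G d lam) (t : kˣ) {r : GL ι k} (hr : r ∈ h.levi) :
    r * lam t = lam t * r := by
  apply Units.ext
  ext i j
  rw [Units.val_mul, Units.val_mul, h.lam_eq, Matrix.diagonal_mul, Matrix.mul_diagonal, mul_comm]
  by_cases hij : d i = d j
  · rw [hij]
  · rw [(h.mem_levi.1 hr).2 i j hij, mul_zero, mul_zero]

/-- The function `g i j - δ i j` vanishes on U, and its differential at 1 is the coordinate `A i j`.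
-/
lemma lieAlg_unip_apply (h : IsContracted G d lam) {A : Matrix ι ι k} (hA : A ∈ lieAlg h.unip)
    {i j : ι} (hij : d i ≤ d j) : A i j = 0 := by
  have := hA (MvPolynomial.X (i, j) - MvPolynomial.C ((1 : Matrix ι ι k) i j)) fun g hg => by
    simp [(h.mem_unip.1 hg).2 i j hij]
  rw [Finset.sum_eq_single (i, j)] at this
  · simpa using this
  · intro p _ hp
    rw [map_sub, MvPolynomial.pderiv_X_of_ne hp.symm]
    simp
  · simp

/-- The part of a matrix in degree `m`, for the grading `d` of the index set. -/
def degreePart (d : ι → ℕ) (m : ℕ) (A : Matrix ι ι k) : Matrix ι ι k :=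
  Matrix.of fun i j => if d i - d j = m then A i j else 0

/-- If `f` vanishes on U, so does each of its rescalings by `t`, because U is stable under
contraction. Applying their differentials to `A` gives a polynomial in `t` that vanishes
identically; its coefficient at `t ^ m` is the differential of `f` applied to the degree `m` part.
-/
lemma degreePart_mem_lieAlg [Infinite k] (h : IsContracted G d lam) {A : Matrix ι ι k}
    (hA : A ∈ lieAlg h.unip) (m : ℕ) : degreePart d m A ∈ lieAlg h.unip := by
  intro f hf
  set a : ι × ι → k := fun p => MvPolynomial.eval (fun p => (1 : Matrix ι ι k) p.1 p.2)
    (MvPolynomial.pderiv p f) with ha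
  have key : ∀ t : k, ∑ p : ι × ι, t ^ (d p.1 - d p.2) * (a p * A p.1 p.2) = 0 := by
    intro t
    have h1 := hA (MvPolynomial.aeval (fun p : ι × ι =>
      MvPolynomial.C (t ^ (d p.1 - d p.2)) * MvPolynomial.X p) f) fun g hg => by
        obtain ⟨g', hg', e⟩ := h.curve_mem_unip hg t
        have h2 := hf g' hg'
        rw [← h2, e, MvPolynomial.eval_rescale]
        rfl
    rw [← h1]
    refine Finset.sum_congr rfl fun p _ => ?_
    rw [MvPolynomial.eval_pderiv_rescale, mul_assoc]
    intro p
    rcases eq_or_ne p.1 p.2 with hp | hp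
    · rw [hp, Nat.sub_self, pow_zero, one_mul]
    · rw [Matrix.one_apply_ne hp, mul_zero]
  have hpoly : ∑ p : ι × ι, Polynomial.monomial (d p.1 - d p.2) (a p * A p.1 p.2) = 0 := by
    refine Polynomial.funext fun t => ?_
    rw [Polynomial.eval_finsetSum, Polynomial.eval_zero, ← key t]
    exact Finset.sum_congr rfl fun p _ => by rw [Polynomial.eval_monomial, mul_comm]
  have := congrArg (Polynomial.coeff · m) hpoly
  simp only [Polynomial.finsetSum_coeff, Polynomial.coeff_monomial, Polynomial.coeff_zero] at this
  rw [← this]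
  refine Finset.sum_congr rfl fun p _ => ?_
  rw [degreePart, Matrix.of_apply]
  split_ifs <;> simp [ha]

lemma isPositivelyGraded [CharZero k] (h : IsContracted G d lam) :
    IsPositivelyGraded (fun t => conj (lam t)) (lieAlg h.unip) := by
  refine ⟨le_antisymm (fun A hA => ?_) (iSup_le fun i A hA => hA.1), fun i hi => ?_⟩
  · have hsum : A = ∑ m ∈ Finset.range (Finset.univ.sup d + 1), degreePart d m A := by
      ext i j
      rw [Matrix.sum_apply]
      simp only [degreePart, Matrix.of_apply, Finset.sum_ite_eq, Finset.mem_range]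
      rw [if_pos]
      have := Finset.le_sup (f := d) (Finset.mem_univ i)
      omega
    rw [hsum]
    refine sum_mem fun m _ => Submodule.mem_iSup_of_mem (m : ℤ) ⟨h.degreePart_mem_lieAlg hA m, ?_⟩
    intro t
    ext i j
    rw [h.conj_lam_apply, Matrix.smul_apply, degreePart, Matrix.of_apply, zpow_natCast,
      Units.val_pow_eq_pow_val, smul_eq_mul]
    split_ifs with hm
    · rcases le_or_gt (d i) (d j) with hij | hij
      · rw [h.lieAlg_unip_apply hA hij]; simp
      · have : (t : k) ^ d j ≠ 0 := pow_ne_zero _ t.ne_zero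
        rw [← hm, pow_sub₀ _ t.ne_zero hij.le]
        ring
    · simp
  · obtain ⟨A, hA, hA0⟩ := (Submodule.ne_bot_iff _).1 hi
    obtain ⟨a, b, hab⟩ : ∃ a b, A a b ≠ 0 := by
      by_contra! hcon
      exact hA0 (Matrix.ext hcon)
    have hlt : d b < d a := by
      by_contra! hcon
      exact hab (h.lieAlg_unip_apply hA.1 hcon)
    by_contra! hneg
    -- In characteristic 0 the element 2 has infinite order, so this single value of `t` determines
    -- the weight.
    let t : kˣ := Units.mk0 2 two_ne_zero
    have h1 := congrFun (congrFun (hA.2 t) a) b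
    rw [h.conj_lam_apply, Matrix.smul_apply, smul_eq_mul, mul_right_comm] at h1
    have h2 := mul_right_cancel₀ hab h1
    obtain ⟨m, rfl⟩ := Int.exists_eq_neg_ofNat hneg
    have h0 : ∀ m : ℕ, (2 : k) ^ m ≠ 0 := fun m => pow_ne_zero m two_ne_zero
    rw [zpow_neg, zpow_natCast, Units.val_inv_eq_inv_val, Units.val_pow_eq_pow_val,
      Units.val_mk0, ← div_eq_mul_inv, div_eq_iff (h0 _), inv_mul_eq_div,
      eq_div_iff (h0 _), ← pow_add] at h2
    have h3 : (2 : ℕ) ^ (d a + m) = 2 ^ d b := by exact_mod_cast h2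
    have := Nat.pow_right_injective le_rfl h3
    omega

end IsContracted

end Levi

end ToricCox

/-! ### Surjective endomorphisms of noetherian rings, and nilpotent matrices. -/

/-- The kernels of the iterates stabilise, say at `n`. If `f x = 0` and `x = f ^ n y`, then `y` is
killed by `f ^ (n + 1)`, hence by `f ^ n`, so `x = 0`. -/
lemma RingHom.injective_of_surjective_of_isNoetherianRing {R : Type*} [CommRing R]
    [IsNoetherianRing R] (f : R →+* R) (hf : Function.Surjective f) : Function.Injective f := by
  have hmono : Monotone fun n : ℕ => RingHom.ker (f ^ n) := by
    refine monotone_nat_of_le_succ fun n x hx => ?_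
    rw [RingHom.mem_ker] at hx ⊢
    rw [pow_succ', RingHom.mul_def, RingHom.comp_apply, hx, map_zero]
  obtain ⟨n, hn⟩ := monotone_stabilizes_iff_noetherian.2 ‹IsNoetherianRing R›
    ⟨fun n => RingHom.ker (f ^ n), hmono⟩
  have hsurj : Function.Surjective (f ^ n) := by
    rw [RingHom.coe_pow]
    exact hf.iterate n
  rw [injective_iff_map_eq_zero]
  intro x hx
  obtain ⟨y, rfl⟩ := hsurj x
  have h1 : y ∈ RingHom.ker (f ^ (n + 1)) := by
    rw [RingHom.mem_ker, pow_succ', RingHom.mul_def, RingHom.comp_apply, hx]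
  exact (hn (n + 1) n.le_succ).ge h1

open scoped Pointwise in
lemma Finsupp.degree_eq_one {σ : Type*} {D : σ →₀ ℕ} (h : D.degree = 1) :
    ∃ i, D = Finsupp.single i 1 := by
  have : D ∈ (1 : ℕ) • (fun x : σ => Finsupp.single x 1) '' (Set.univ : Set σ) := by
    rw [Finsupp.nsmul_single_one_image]
    exact ⟨h, Set.subset_univ _⟩
  rw [one_smul] at this
  obtain ⟨i, -, hi⟩ := this
  exact ⟨i, hi.symm⟩

namespace Matrix

/-- Nilpotent matrices have trace 0. With `E` the matrix unit at `(i, j)`, cyclicity of the trace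
and `E * E = 0` reduce the trace in the hypothesis to `-tr (A E A E) = -(A j i) ^ 2`. So `A` is
diagonal, and a nilpotent diagonal matrix is 0. -/
lemma eq_zero_of_isNilpotent_transvection {k m : Type*} [Field k] [Fintype m] [DecidableEq m]
    {A : Matrix m m k} (hA : IsNilpotent A)
    (h : ∀ i j, i ≠ j → IsNilpotent
      ((1 + A) * (transvection i j 1 * (1 + A) * transvection i j (-1)) - 1)) : A = 0 := by
  have hoff : ∀ i j, i ≠ j → A j i = 0 := by
    intro i j hij
    have htr : ∀ B : Matrix m m k, IsNilpotent B → B.trace = 0 := fun B hB =>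
      (isNilpotent_trace_of_isNilpotent hB).eq_zero
    have hAA : IsNilpotent (A * A) := (Commute.refl A).isNilpotent_mul_right hA
    have h1 := htr _ (h i j hij)
    set E : Matrix m m k := single i j 1 with hE
    have hE2 : E * E = 0 := single_mul_single_of_ne _ _ _ _ hij.symm _
    have e : (1 + A) * (transvection i j 1 * (1 + A) * transvection i j (-1)) - 1 =
        A + (A + E * A - A * E - E * A * E) + (A * A + A * E * A - A * A * E - A * E * A * E) := by
      have : transvection i j (-1 : k) = 1 - E := by
        rw [transvection, hE, sub_eq_add_neg, ← single_neg]
      rw [this, transvection, ← hE]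
      have : (1 + E) * (1 + A) * (1 - E) = 1 - E * E + (A + E * A - A * E - E * A * E) := by
        noncomm_ring
      rw [this, hE2]
      noncomm_ring
    rw [e] at h1
    simp only [trace_add, trace_sub] at h1
    rw [trace_mul_comm A E, htr A hA, htr _ hAA, mul_assoc E A E, trace_mul_comm E (A * E),
      mul_assoc A E E, hE2, trace_mul_comm (A * E) A, ← mul_assoc A A E] at h1
    have h2 : (A * E * A * E).trace = A j i * A j i := by
      rw [mul_assoc (A * E), mul_assoc A E, ← mul_assoc E A E, hE, single_mul_mul_single,
        trace_mul_single]
      simp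
    rw [h2] at h1
    simpa using h1
  obtain ⟨v, rfl⟩ : ∃ v, A = diagonal v := by
    refine ⟨fun i => A i i, ?_⟩
    ext i j
    rcases eq_or_ne i j with rfl | hij
    · simp
    · rw [hoff j i hij.symm, diagonal_apply_ne _ hij]
  obtain ⟨n, hn⟩ := hA
  rw [diagonal_pow, ← diagonal_zero, diagonal_injective.eq_iff] at hn
  have : v = 0 := by
    funext i
    exact eq_zero_of_pow_eq_zero (congrFun hn i)
  rw [this]
  exact diagonal_zero

lemma submatrix_mul_of_row {k m ι : Type*} [CommRing k] [Fintype m] [Fintype ι] {s : m → ι}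
    (hs : Function.Injective s) {A : Matrix ι ι k} (hA : ∀ i l, l ∉ Set.range s → A (s i) l = 0)
    (B : Matrix ι ι k) : (A * B).submatrix s s = A.submatrix s s * B.submatrix s s := by
  classical
  ext i j
  rw [submatrix_apply, mul_apply, mul_apply, ← Finset.sum_subset
    (Finset.subset_univ (Finset.univ.map ⟨s, hs⟩)), Finset.sum_map]
  · rfl
  · intro l _ hl
    rw [hA i l (by simpa using hl), zero_mul]

lemma submatrix_pow_of_row {k m ι : Type*} [CommRing k] [Fintype m] [Fintype ι] [DecidableEq m]
    [DecidableEq ι] {s : m → ι} (hs : Function.Injective s) {A : Matrix ι ι k}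
    (hA : ∀ i l, l ∉ Set.range s → A (s i) l = 0) (n : ℕ) :
    (A ^ n).submatrix s s = A.submatrix s s ^ n := by
  induction n with
  | zero => rw [pow_zero, pow_zero, submatrix_one _ hs]
  | succ n ih => rw [pow_succ', pow_succ', submatrix_mul_of_row hs hA, ih]

end Matrix

/-! ### The graded automorphism group of the Cox ring as a contracted group. -/

namespace ToricCox.CompleteFan

open MvPolynomial

variable {n : ℕ} (F : CompleteFan n) {k : Type*} [Field k]

/-- The class of a variable, as one of the classes of variables. -/
abbrev varClass (ρ : F.Ray) : F.VarClass := ⟨F.rayClass ρ, ρ, rfl⟩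

/-- The position of a variable among the monomials of its class. -/
abbrev varIndex (ρ : F.Ray) : F.Idx (F.varClass ρ) := Sum.inl ⟨ρ, rfl⟩

/-- The total degree of a basis monomial. -/
def indexDegree (i : F.Index) : ℕ := (F.expo i.2).degree

/-- A variable of degree 0 would have infinitely many powers of degree 0, against the finiteness of
graded pieces for a complete fan. -/
lemma ne_zero_of_monClass {D : F.Ray →₀ ℕ} {α : F.VarClass} (hD : F.monClass D = α) : D ≠ 0 := by
  rintro rfl
  obtain ⟨α, ρ, rfl⟩ := α
  have h0 : F.rayClass ρ = 0 := hD.symm.trans (map_zero _)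
  refine Set.infinite_of_injective_forall_mem (f := fun m : ℕ => Finsupp.single ρ m)
    (Finsupp.single_injective ρ) (fun m => ?_) (F.finite_monomials 0)
  change F.monClass _ = 0
  rw [Fan.monClass, Finsupp.weight_single, h0, smul_zero]

/-- The image of a variable has no constant term, since 1 does not have the degree of a variable. So
the automorphism maps the ideal of the variables, and each of its powers, into itself. -/
lemma map_monomial_mem (φ : F.autGr k) (D : F.Ray →₀ ℕ) :
    φ.1 (monomial D 1) ∈ idealOfVars F.Ray k ^ D.degree := by
  have hle : idealOfVars F.Ray k ≤ (idealOfVars F.Ray k).comap φ.1 := by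
    rw [idealOfVars, Ideal.span_le]
    rintro _ ⟨ρ, rfl⟩
    rw [SetLike.mem_coe, Ideal.mem_comap, ← idealOfVars, ← pow_one (idealOfVars F.Ray k),
      mem_pow_idealOfVars_iff']
    intro D hD
    by_contra hne
    have h1 := F.mem_piece.1 ((φ.2 (F.varClass ρ) (X ρ)).2
      (F.monomial_mem_piece k (F.varIndex ρ))) D hne
    refine F.ne_zero_of_monClass h1 ?_
    rw [← Finsupp.degree_eq_zero_iff]
    omega
  have h1 : (monomial D (1 : k)) ∈ idealOfVars F.Ray k ^ D.degree :=
    (monomial_mem_pow_idealOfVars_iff _ _ one_ne_zero).2 le_rfl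
  exact Ideal.le_comap_pow φ.1 _ (Ideal.pow_right_mono hle _ h1)

lemma toGL_apply_same (φ : F.autGr k) (α : F.VarClass) (E D : F.Idx α) :
    (F.toGL k φ).1 ⟨α, E⟩ ⟨α, D⟩ = coeff (F.expo E) (φ.1 (monomial (F.expo D) 1)) :=
  Matrix.blockDiagonal'_apply_eq _ _ _ _

lemma toGL_apply_ne (φ : F.autGr k) {i j : F.Index} (h : i.1 ≠ j.1) :
    (F.toGL k φ).1 i j = 0 :=
  Matrix.blockDiagonal'_apply_ne _ _ _ h

lemma toGL_lower (φ : F.autGr k) : (F.toGL k φ).1 ∈ lowerSubalgebra k F.indexDegree := by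
  rintro ⟨α, E⟩ ⟨β, D⟩ h
  rcases eq_or_ne α β with rfl | hne
  · rw [toGL_apply_same]
    exact (mem_pow_idealOfVars_iff' _ _).1 (F.map_monomial_mem φ _) _ h
  · exact F.toGL_apply_ne φ hne

lemma toGL_distinguished (t : kˣ) : (F.toGL k (F.distinguished k t)).1 =
    Matrix.diagonal fun i => ((t⁻¹ : kˣ) : k) ^ F.indexDegree i := by
  ext ⟨α, E⟩ ⟨β, D⟩
  rcases eq_or_ne α β with rfl | hne
  · rw [toGL_apply_same]
    change coeff _ (F.scale ((t⁻¹ : kˣ) : k) _) = _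
    rw [Fan.coeff_scale, coeff_monomial, Matrix.diagonal_apply]
    have : (F.expo D = F.expo E) ↔ (⟨α, E⟩ : F.Index) = ⟨α, D⟩ := by
      rw [F.expo_injective.eq_iff, Sigma.mk.injEq]
      simp [eq_comm]
    rw [if_congr this rfl rfl, mul_ite, mul_one, mul_zero]
    rfl
  · rw [F.toGL_apply_ne _ hne, Matrix.diagonal_apply_ne]
    exact fun h => hne (congrArg Sigma.fst h)

/-! ### Graded endomorphisms -/

lemma map_mem_piece {f : F.CoxRing k →ₐ[k] F.CoxRing k}
    (hf : ∀ ρ, f (X ρ) ∈ F.piece k (F.rayClass ρ)) {α : F.Cl} {p : F.CoxRing k}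
    (hp : p ∈ F.piece k α) : f p ∈ F.piece k α := by
  rw [p.as_sum, map_sum]
  refine sum_mem fun D hD => ?_
  rw [← F.mem_piece.1 hp D (mem_support_iff.1 hD), monomial_eq, ← algebraMap_eq, map_mul,
    AlgHom.commutes, algebraMap_eq, ← smul_eq_C_mul]
  refine Submodule.smul_mem _ _ ?_
  rw [Finsupp.prod, map_prod, Fan.monClass, Finsupp.weight_apply, Finsupp.sum]
  refine IsWeightedHomogeneous.prod _ _ _ fun ρ _ => ?_
  rw [map_pow]
  exact IsWeightedHomogeneous.pow (hf ρ) _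

/-- A graded automorphism, from mutually inverse graded endomorphisms. -/
def mkAut (f g : F.CoxRing k →ₐ[k] F.CoxRing k)
    (hf : ∀ ρ, f (X ρ) ∈ F.piece k (F.rayClass ρ)) (hg : ∀ ρ, g (X ρ) ∈ F.piece k (F.rayClass ρ))
    (hfg : f.comp g = AlgHom.id k _) (hgf : g.comp f = AlgHom.id k _) : F.autGr k :=
  ⟨AlgEquiv.ofAlgHom f g hfg hgf, fun α p =>
    ⟨fun h => by
      have h1 : g (f p) ∈ F.piece k α := F.map_mem_piece hg h
      rwa [← AlgHom.comp_apply, hgf] at h1, F.map_mem_piece hf⟩⟩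

/-- The endomorphism that takes the variables to the linear combinations of monomials given by
the columns of a matrix. -/
def substHom {A : Type*} [CommRing A] (M : Matrix F.Index F.Index A) :
    MvPolynomial F.Ray A →ₐ[A] MvPolynomial F.Ray A :=
  aeval fun ρ => ∑ E, monomial (F.expo E) (M ⟨F.varClass ρ, E⟩ ⟨F.varClass ρ, F.varIndex ρ⟩)

/-- Specialising the generic matrix to `g` through this base change shows that coefficients of
substituted monomials are polynomials in the entries of `g`. -/
lemma map_substHom {A B : Type*} [CommRing A] [CommRing B] (f : A →+* B)
    (M : Matrix F.Index F.Index A) (p : MvPolynomial F.Ray A) :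
    map f (F.substHom M p) = F.substHom (M.map f) (map f p) := by
  induction p using MvPolynomial.induction_on with
  | C a => simp [substHom, algebraMap_eq]
  | add p q hp hq => simp only [map_add, hp, hq]
  | mul_X p ρ hp =>
    simp only [map_mul, hp, map_X]
    simp [substHom, map_monomial]

lemma substHom_toGL (φ : F.autGr k) : F.substHom (F.toGL k φ).1 = φ.1 := by
  refine algHom_ext fun ρ => ?_
  rw [substHom, aeval_X]
  have h1 := (φ.2 (F.varClass ρ) (X ρ)).2 (F.monomial_mem_piece k (F.varIndex ρ))
  refine Eq.trans ?_ (F.eq_sum_of_mem_piece h1).symm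
  refine Finset.sum_congr rfl fun E _ => ?_
  rw [toGL_apply_same, smul_monomial, smul_eq_mul, mul_one]
  rfl

lemma substHom_X_mem (M : Matrix F.Index F.Index k) (ρ : F.Ray) :
    F.substHom M (X ρ) ∈ F.piece k (F.rayClass ρ) := by
  rw [substHom, aeval_X]
  refine sum_mem fun E _ => ?_
  rw [← mul_one (M _ _), ← smul_eq_mul, ← smul_monomial]
  exact Submodule.smul_mem _ _ (F.monomial_mem_piece k E)

/-- The equations say that `g` is block diagonal and that its columns are those forced by
multiplicativity from the columns of the variables. Then `substHom g` acts on each piece through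
`g`, so substitution by `g⁻¹` is a right inverse. Being surjective on a noetherian ring, `substHom
g` is also injective, hence an automorphism. -/
lemma mem_range_toGL (g : GL F.Index k) : g ∈ (F.toGL k).range ↔
    (∀ α E D, g.1 ⟨α, E⟩ ⟨α, D⟩ = coeff (F.expo E) (F.substHom g.1 (monomial (F.expo D) 1))) ∧
      ∀ i j, i.1 ≠ j.1 → g.1 i j = 0 := by
  constructor
  · rintro ⟨φ, rfl⟩
    refine ⟨fun α E D => ?_, fun i j => F.toGL_apply_ne φ⟩
    rw [substHom_toGL]
    exact F.toGL_apply_same φ α E D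
  · rintro ⟨h1, h2⟩
    have hfg : (F.substHom g.1).comp (F.substHom (g⁻¹).1) = AlgHom.id k _ := by
      refine algHom_ext fun ρ => ?_
      have hE : ∀ E : F.Idx (F.varClass ρ), F.substHom g.1 (monomial (F.expo E) 1) =
          ∑ E' : F.Idx (F.varClass ρ), monomial (F.expo E') (g.1 ⟨_, E'⟩ ⟨_, E⟩) := by
        intro E
        refine (F.eq_sum_of_mem_piece
          (F.map_mem_piece (F.substHom_X_mem g.1) (F.monomial_mem_piece k E))).trans ?_
        refine Finset.sum_congr rfl fun E' _ => ?_
        rw [h1, smul_monomial, smul_eq_mul, mul_one]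
      -- This is one block of `g * g⁻¹ = 1`; the terms from other blocks vanish because `g` is block
      -- diagonal.
      have hinv : ∀ E' E : F.Idx (F.varClass ρ),
          ∑ K : F.Idx (F.varClass ρ), (g⁻¹).1 ⟨_, K⟩ ⟨_, E⟩ * g.1 ⟨_, E'⟩ ⟨_, K⟩ =
            if E' = E then 1 else 0 := by
        intro E' E
        have h3 : (g.1 * (g⁻¹).1) ⟨_, E'⟩ ⟨_, E⟩ =
            (1 : Matrix F.Index F.Index k) ⟨F.varClass ρ, E'⟩ ⟨F.varClass ρ, E⟩ := by
          rw [← Units.val_mul, mul_inv_cancel, Units.val_one]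
        rw [Matrix.mul_apply, Fintype.sum_sigma, Finset.sum_eq_single (F.varClass ρ)] at h3
        · simp only [mul_comm ((g⁻¹).1 _ _), h3, Matrix.one_apply, Sigma.mk.injEq, heq_eq_eq,
            true_and]
        · intro β _ hβ
          exact Finset.sum_eq_zero fun K _ => by rw [h2 _ _ hβ.symm, zero_mul]
        · simp
      rw [AlgHom.comp_apply, AlgHom.id_apply]
      nth_rw 2 [substHom]
      rw [aeval_X, map_sum]
      have : ∀ E : F.Idx (F.varClass ρ), F.substHom g.1
          (monomial (F.expo E) ((g⁻¹).1 ⟨_, E⟩ ⟨F.varClass ρ, F.varIndex ρ⟩)) =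
          ∑ E' : F.Idx (F.varClass ρ), monomial (F.expo E')
            ((g⁻¹).1 ⟨_, E⟩ ⟨F.varClass ρ, F.varIndex ρ⟩ * g.1 ⟨_, E'⟩ ⟨_, E⟩) := by
        intro E
        rw [← mul_one ((g⁻¹).1 _ _), ← smul_eq_mul, ← smul_monomial, map_smul, hE,
          Finset.smul_sum]
        simp only [smul_monomial, smul_eq_mul, mul_one]
      rw [Finset.sum_congr rfl fun E _ => this E, Finset.sum_comm]
      simp only [← map_sum, hinv]
      rw [Finset.sum_eq_single (F.varIndex ρ)]
      · rw [if_pos rfl]; rfl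
      · intro E _ hE
        rw [if_neg hE, map_zero]
      · simp
    have hsurj : Function.Surjective (F.substHom g.1) := fun p =>
      ⟨F.substHom (g⁻¹).1 p, DFunLike.congr_fun hfg p⟩
    have hinj : Function.Injective (F.substHom g.1) :=
      RingHom.injective_of_surjective_of_isNoetherianRing (F.substHom g.1).toRingHom hsurj
    have hgf : (F.substHom (g⁻¹).1).comp (F.substHom g.1) = AlgHom.id k _ :=
      AlgHom.ext fun p => hinj (DFunLike.congr_fun hfg (F.substHom g.1 p))
    refine ⟨F.mkAut _ _ (F.substHom_X_mem _) (F.substHom_X_mem _) hfg hgf, Units.ext ?_⟩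
    ext ⟨α, E⟩ ⟨β, D⟩
    rcases eq_or_ne α β with rfl | hne
    · rw [toGL_apply_same, h1]
      rfl
    · rw [F.toGL_apply_ne _ hne, h2 _ _ hne]

lemma isZariskiClosed_range_toGL :
    IsZariskiClosed ((F.toGL k).range : Set (GL F.Index k)) := by
  refine (isClosed_zariski_iff _).2 ⟨
    {f | ∃ α E D, f = X (⟨α, E⟩, ⟨α, D⟩) - coeff (F.expo E) (F.substHom
      (Matrix.of fun i j : F.Index => (X (i, j) : MvPolynomial (F.Index × F.Index) k))
      (monomial (F.expo D) 1))} ∪ {f | ∃ i j : F.Index, i.1 ≠ j.1 ∧ f = X (i, j)}, ?_⟩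
  ext g
  -- The equations are written with the generic matrix; evaluating it at `g` recovers the conditions
  -- of `mem_range_toGL`.
  have hev : ∀ α (E D : F.Idx α), eval (fun p : F.Index × F.Index => g.1 p.1 p.2)
      (X (⟨α, E⟩, ⟨α, D⟩) - coeff (F.expo E) (F.substHom
      (Matrix.of fun i j : F.Index => (X (i, j) : MvPolynomial (F.Index × F.Index) k))
      (monomial (F.expo D) 1))) =
      g.1 ⟨α, E⟩ ⟨α, D⟩ - coeff (F.expo E) (F.substHom g.1 (monomial (F.expo D) 1)) := by
    intro α E D
    rw [map_sub, eval_X, ← coeff_map, map_substHom, map_monomial, map_one]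
    congr 4
    ext i j
    simp
  rw [SetLike.mem_coe, mem_range_toGL]
  constructor
  · rintro ⟨h1, h2⟩ f (⟨α, E, D, rfl⟩ | ⟨i, j, hij, rfl⟩)
    · rw [hev, h1, sub_self]
    · rw [eval_X, h2 i j hij]
  · intro h
    refine ⟨fun α E D => ?_, fun i j hij => ?_⟩
    · have := h _ (Or.inl ⟨α, E, D, rfl⟩)
      rwa [hev, sub_eq_zero] at this
    · have := h _ (Or.inr ⟨i, j, hij, rfl⟩)
      rwa [eval_X] at this

/-- The inverse of the distinguished one-parameter subgroup, in the group of matrices. -/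
def invDistinguished (k : Type*) [Field k] : kˣ →* GL F.Index k :=
  ((F.toGL k).comp (F.distinguished k)).comp invMonoidHom

/-- The inverse of `λ_g` is the right group here: `λ_g` scales variables by `t⁻¹`, so its inverse is
the diagonal group with nonnegative exponents `d`. -/
lemma isContracted : IsContracted (F.toGL k).range F.indexDegree (F.invDistinguished k) where
  closed := F.isZariskiClosed_range_toGL
  lower := by
    rintro _ ⟨φ, rfl⟩
    exact F.toGL_lower φ
  lam_eq t := by
    change (F.toGL k (F.distinguished k t⁻¹)).1 = _
    rw [toGL_distinguished, inv_inv]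
  lam_mem t := ⟨_, rfl⟩

/-! ### The Levi subgroup -/

/-- An automorphism that is linear on the variables preserves the total degree of every monomial. -/
lemma toGL_mem_levi {φ : F.autGr k} (hφ : ∀ ρ, (φ.1 (X ρ)).IsHomogeneous 1) :
    F.toGL k φ ∈ F.isContracted.levi := by
  refine F.isContracted.mem_levi.2 ⟨⟨φ, rfl⟩, ?_⟩
  rintro ⟨α, E⟩ ⟨β, D⟩ hij
  rcases eq_or_ne α β with rfl | hne
  · rw [toGL_apply_same]
    have h1 : (φ.1 (monomial (F.expo D) 1)).IsHomogeneous (1 * (F.expo D).degree) := by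
      have h2 : (φ.1 : F.CoxRing k →ₐ[k] F.CoxRing k) = aeval fun ρ => φ.1 (X ρ) :=
        algHom_ext fun ρ => by simp
      change ((φ.1 : F.CoxRing k →ₐ[k] F.CoxRing k) (monomial (F.expo D) 1)).IsHomogeneous _
      rw [h2]
      exact (isHomogeneous_monomial 1 rfl).aeval _ hφ
    rw [one_mul] at h1
    exact h1.coeff_eq_zero hij
  · exact F.toGL_apply_ne φ hne

/-- The transvection `x_τ ↦ x_τ + c x_ρ` of the Cox ring. -/
def transvectionHom (ρ τ : F.Ray) (c : k) : F.CoxRing k →ₐ[k] F.CoxRing k :=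
  aeval fun σ => if σ = τ then X τ + c • X ρ else X σ

lemma transvectionHom_X_mem {ρ τ : F.Ray} (h : F.rayClass ρ = F.rayClass τ) (c : k) (σ : F.Ray) :
    F.transvectionHom ρ τ c (X σ) ∈ F.piece k (F.rayClass σ) := by
  have hX : ∀ σ, (X σ : F.CoxRing k) ∈ F.piece k (F.rayClass σ) :=
    isWeightedHomogeneous_X k F.rayClass
  rw [transvectionHom, aeval_X]
  split_ifs with hσ
  · rw [hσ]
    exact add_mem (hX τ) (Submodule.smul_mem _ _ (h ▸ hX ρ))
  · exact hX σ

lemma transvectionHom_comp {ρ τ : F.Ray} (h : ρ ≠ τ) {c d : k} (hcd : c + d = 0) :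
    (F.transvectionHom ρ τ c).comp (F.transvectionHom ρ τ d) = AlgHom.id k _ := by
  refine algHom_ext fun σ => ?_
  have h1 : ∀ (c : k) σ, F.transvectionHom ρ τ c (X σ) = if σ = τ then X τ + c • X ρ else X σ :=
    fun c σ => aeval_X _ _
  rw [AlgHom.comp_apply, h1, AlgHom.id_apply]
  split_ifs with hσ
  · rw [map_add, map_smul, h1, h1, if_pos rfl, if_neg h, add_assoc, ← add_smul, hcd, zero_smul,
      add_zero, hσ]
  · rw [h1, if_neg hσ]

/-- The transvection `x_τ ↦ x_τ + c x_ρ` as a graded automorphism. -/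
def transvectionAut {ρ τ : F.Ray} (h : F.rayClass ρ = F.rayClass τ) (hne : ρ ≠ τ) (c : k) :
    F.autGr k :=
  F.mkAut (F.transvectionHom ρ τ c) (F.transvectionHom ρ τ (-c)) (F.transvectionHom_X_mem h c)
    (F.transvectionHom_X_mem h (-c)) (F.transvectionHom_comp hne (add_neg_cancel c))
    (F.transvectionHom_comp hne (neg_add_cancel c))

lemma transvectionAut_X {ρ τ : F.Ray} (h : F.rayClass ρ = F.rayClass τ) (hne : ρ ≠ τ) (c : k)
    (σ : F.Ray) :
    (F.transvectionAut h hne c).1 (X σ) = if σ = τ then X τ + c • X ρ else X σ :=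
  aeval_X _ _

lemma transvectionAut_mul {ρ τ : F.Ray} (h : F.rayClass ρ = F.rayClass τ) (hne : ρ ≠ τ) (c : k) :
    F.transvectionAut h hne c * F.transvectionAut h hne (-c) = 1 := by
  refine Subtype.ext (AlgEquiv.ext fun p => ?_)
  exact DFunLike.congr_fun (F.transvectionHom_comp hne (add_neg_cancel c)) p

lemma transvectionAut_mem_levi {ρ τ : F.Ray} (h : F.rayClass ρ = F.rayClass τ) (hne : ρ ≠ τ)
    (c : k) : F.toGL k (F.transvectionAut h hne c) ∈ F.isContracted.levi := by
  refine F.toGL_mem_levi fun σ => ?_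
  rw [transvectionAut_X]
  split_ifs
  · exact (isHomogeneous_X k τ).add ((homogeneousSubmodule F.Ray k 1).smul_mem c
      (isHomogeneous_X k ρ))
  · exact isHomogeneous_X k σ

/-- The position of a variable among all basis monomials. -/
def linIndex {α : F.VarClass} (ρ : F.Lin α) : F.Index := ⟨α, Sum.inl ρ⟩

lemma linIndex_injective {α : F.VarClass} : Function.Injective (F.linIndex (α := α)) := by
  intro ρ τ h
  exact Sum.inl_injective (eq_of_heq (Sigma.mk.inj h).2)

lemma indexDegree_linIndex {α : F.VarClass} (ρ : F.Lin α) : F.indexDegree (F.linIndex ρ) = 1 :=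
  Finsupp.degree_single _ _

lemma one_lt_degree {α : F.VarClass} (D : F.NonLin α) : 1 < D.1.degree := by
  rw [Nat.one_lt_iff_ne_zero_and_ne_one]
  refine ⟨fun h => F.ne_zero_of_monClass D.2.1 ((Finsupp.degree_eq_zero_iff _).1 h), fun h => ?_⟩
  obtain ⟨ρ, hρ⟩ := Finsupp.degree_eq_one h
  exact D.2.2 ρ hρ

/-- The image of a monomial of total degree at least 2 has no linear term. Hence linear parts
multiply, and nilpotency passes to them. -/
lemma toGL_linIndex_eq_zero (φ : F.autGr k) {α : F.VarClass} (ρ : F.Lin α) {l : F.Index}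
    (hl : l ∉ Set.range (F.linIndex (α := α))) : (F.toGL k φ).1 (F.linIndex ρ) l = 0 := by
  obtain ⟨β, τ | D⟩ := l
  · refine F.toGL_apply_ne φ ?_
    rintro rfl
    exact hl ⟨τ, rfl⟩
  · refine F.toGL_lower φ _ _ ?_
    rw [indexDegree_linIndex]
    exact F.one_lt_degree D

/-- The matrix of the linear part of an automorphism on the variables of one class. -/
def linPart (φ : F.autGr k) (α : F.VarClass) : Matrix (F.Lin α) (F.Lin α) k :=
  (F.toGL k φ).1.submatrix F.linIndex F.linIndex

lemma linPart_mul (φ ψ : F.autGr k) (α : F.VarClass) :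
    F.linPart (φ * ψ) α = F.linPart φ α * F.linPart ψ α := by
  rw [linPart, map_mul]
  exact Matrix.submatrix_mul_of_row F.linIndex_injective
    (fun ρ _ hl => F.toGL_linIndex_eq_zero φ ρ hl) _

lemma isNilpotent_linPart_sub_one {φ : F.autGr k} (h : IsNilpotent ((F.toGL k φ).1 - 1))
    (α : F.VarClass) : IsNilpotent (F.linPart φ α - 1) := by
  obtain ⟨m, hm⟩ := h
  refine ⟨m, ?_⟩
  have h1 := Matrix.submatrix_pow_of_row (F.linIndex_injective (α := α))
    (A := (F.toGL k φ).1 - 1) (fun ρ l hl => by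
      rw [Matrix.sub_apply, F.toGL_linIndex_eq_zero φ ρ hl, Matrix.one_apply_ne, sub_zero]
      exact fun e => hl ⟨ρ, e⟩) m
  rw [Matrix.submatrix_sub, Pi.sub_apply, Pi.sub_apply, Matrix.submatrix_one _ F.linIndex_injective,
    hm] at h1
  exact h1.symm

lemma linPart_transvectionAut {α : F.VarClass} {ρ τ : F.Lin α}
    (h : F.rayClass ρ.1 = F.rayClass τ.1) (hne : ρ.1 ≠ τ.1) (c : k) :
    F.linPart (F.transvectionAut h hne c) α = Matrix.transvection ρ τ c := by
  ext σ υ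
  rw [linPart, Matrix.submatrix_apply, linIndex, linIndex, toGL_apply_same]
  change coeff (Finsupp.single σ.1 1) ((F.transvectionAut h hne c).1 (X υ.1)) = _
  rw [transvectionAut_X, Matrix.transvection, Matrix.add_apply, Matrix.one_apply,
    Matrix.single_apply]
  have hX : ∀ υ : F.Lin α, coeff (Finsupp.single σ.1 1) (X υ.1 : F.CoxRing k) =
      if σ = υ then 1 else 0 := by
    intro υ
    rw [coeff_X]
    refine if_congr ?_ rfl rfl
    rw [Finsupp.single_left_inj one_ne_zero, ← Subtype.ext_iff, eq_comm]
  split_ifs with h1 h2 h3 h3 h4 <;>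
    simp_all [Subtype.ext_iff, eq_comm]

/-- A Levi element sends each variable to a linear form, so the linear parts already determine the
automorphism. -/
lemma eq_one_of_mem_levi {φ : F.autGr k} (hφ : F.toGL k φ ∈ F.isContracted.levi)
    (h1 : ∀ α, F.linPart φ α = 1) : φ = 1 := by
  refine Subtype.ext (AlgEquiv.coe_toAlgHom_injective (algHom_ext fun ρ => ?_))
  rw [← substHom_toGL, substHom, aeval_X, Finset.sum_eq_single (F.varIndex ρ)]
  · have := congrFun (congrFun (h1 (F.varClass ρ)) ⟨ρ, rfl⟩) ⟨ρ, rfl⟩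
    rw [Matrix.one_apply_eq] at this
    have e : (F.toGL k φ).1 ⟨F.varClass ρ, F.varIndex ρ⟩ ⟨F.varClass ρ, F.varIndex ρ⟩ = 1 := this
    rw [e]
    rfl
  · rintro (τ | D) _ hE
    · have := congrFun (congrFun (h1 (F.varClass ρ)) τ) ⟨ρ, rfl⟩
      rw [Matrix.one_apply_ne (fun e => hE (by rw [e]))] at this
      have e : (F.toGL k φ).1 ⟨F.varClass ρ, Sum.inl τ⟩ ⟨F.varClass ρ, F.varIndex ρ⟩ = 0 := this
      rw [e, map_zero]
    · rw [(F.isContracted.mem_levi.1 hφ).2, map_zero]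
      exact ne_of_gt ((F.indexDegree_linIndex (⟨ρ, rfl⟩ : F.Lin (F.varClass ρ))).trans_lt
        (F.one_lt_degree D))
  · simp

lemma eq_bot_of_normal_isUnipotent (N : Subgroup (GL F.Index k))
    (hN : N ≤ (F.isContracted (k := k)).levi)
    (hn : (N.subgroupOf (F.isContracted (k := k)).levi).Normal) (hu : IsUnipotent N) : N = ⊥ := by
  rw [Subgroup.eq_bot_iff_forall]
  intro g hg
  obtain ⟨φ, rfl⟩ := F.isContracted.levi_le (hN hg)
  rw [F.eq_one_of_mem_levi (hN hg) fun α => ?_, map_one]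
  rw [← sub_eq_zero]
  refine Matrix.eq_zero_of_isNilpotent_transvection
    (F.isNilpotent_linPart_sub_one (hu _ hg) α) fun ρ τ hρτ => ?_
  have hne : ρ.1 ≠ τ.1 := fun h => hρτ (Subtype.ext h)
  have hc : F.rayClass ρ.1 = F.rayClass τ.1 := ρ.2.trans τ.2.symm
  set T := F.transvectionAut hc hne (1 : k) with hT
  have hinv : T⁻¹ = F.transvectionAut hc hne (-1) :=
    inv_eq_of_mul_eq_one_right (F.transvectionAut_mul hc hne 1)
  have hconj := hn.conj_mem ⟨F.toGL k φ, hN hg⟩ hg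
    ⟨F.toGL k T, F.transvectionAut_mem_levi hc hne 1⟩
  -- Normality puts the conjugate by `T` in `N`; the product is then unipotent, which is the
  -- hypothesis of the transvection criterion.
  have hmem : F.toGL k (φ * (T * φ * T⁻¹)) ∈ N := by
    rw [map_mul, map_mul, map_mul, map_inv]
    exact mul_mem hg hconj
  have := F.isNilpotent_linPart_sub_one (hu _ hmem) α
  rwa [linPart_mul, linPart_mul, linPart_mul, hinv, hT, linPart_transvectionAut,
    linPart_transvectionAut, ← add_sub_cancel 1 (F.linPart φ α)] at this

/-! ### The unipotent radical -/

/-- Variables all have total degree 1, so `gr φ` has the same linear parts as `φ`. If these are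
trivial, the Levi element `gr φ` is 1, and all other diagonal blocks are trivial as well. -/
lemma mem_unip_iff_linPart [Infinite k] (φ : F.autGr k) :
    F.toGL k φ ∈ F.isContracted.unip ↔ ∀ α, F.linPart φ α = 1 := by
  rw [F.isContracted.mem_unip]
  constructor
  · rintro ⟨-, h⟩ α
    ext ρ τ
    rw [linPart, Matrix.submatrix_apply, h _ _ (by rw [indexDegree_linIndex, indexDegree_linIndex]),
      ← Matrix.submatrix_apply (1 : Matrix F.Index F.Index k),
      Matrix.submatrix_one _ F.linIndex_injective]
  · intro h
    refine F.isContracted.mem_unip.1 ⟨⟨F.toGL k φ, φ, rfl⟩, ?_, rfl⟩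
    have hlevi := (F.isContracted (k := k)).gr_mem_levi ⟨F.toGL k φ, φ, rfl⟩
    obtain ⟨ψ, hψ⟩ := F.isContracted.levi_le hlevi
    rw [← hψ] at hlevi
    change F.isContracted.gr _ = 1
    rw [← hψ, F.eq_one_of_mem_levi hlevi fun α => ?_, map_one]
    rw [← h α]
    ext ρ τ
    rw [linPart, hψ, IsContracted.gr_val, Matrix.submatrix_apply, blockPart_apply,
      if_pos (by rw [indexDegree_linIndex, indexDegree_linIndex])]
    rfl

/-- The order refines total degree, so being trivial on and above the degree blocks gives the stated
shape. Conversely, the identity block on the variables alone suffices, by `mem_unip_iff_linPart`. -/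
lemma mem_unip_iff_blockMatrix [Infinite k] (ord : ∀ α : F.VarClass, LinearOrder (F.NonLin α))
    (hord : ∀ (α : F.VarClass) (D E : F.NonLin α), D.1.degree < E.1.degree → (ord α).lt D E)
    (φ : F.autGr k) : F.toGL k φ ∈ F.isContracted.unip ↔
      ∀ α : F.VarClass, ∃ (B : Matrix (F.NonLin α) (F.Lin α) k)
        (C : Matrix (F.NonLin α) (F.NonLin α) k),
        F.blockMatrix φ α = Matrix.fromBlocks 1 0 B C ∧ IsLowerUnitriangular (ord α) C := by
  constructor
  · intro h α
    have h1 : ∀ E D : F.Idx α, (F.expo E).degree ≤ (F.expo D).degree →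
        F.blockMatrix φ α E D = if E = D then 1 else 0 := by
      intro E D hED
      have := (F.isContracted.mem_unip.1 h).2 ⟨α, E⟩ ⟨α, D⟩ hED
      rw [toGL_apply_same, Matrix.one_apply] at this
      refine Eq.trans this (if_congr ?_ rfl rfl)
      simp
    refine ⟨(F.blockMatrix φ α).toBlocks₂₁, (F.blockMatrix φ α).toBlocks₂₂, ?_, ?_, ?_⟩
    · rw [← Matrix.fromBlocks_toBlocks (F.blockMatrix φ α)]
      congr 1
      · have := (F.mem_unip_iff_linPart φ).1 h α
        rw [← this]
        ext ρ τ
        exact (F.toGL_apply_same φ α _ _).symm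
      · ext ρ D
        refine (h1 (Sum.inl ρ) (Sum.inr D) ?_).trans (if_neg Sum.inl_ne_inr)
        exact (Finsupp.degree_single ρ.1 1).trans_le (F.one_lt_degree D).le
    · intro D E hDE
      have hne : D ≠ E := by
        rintro rfl
        exact absurd hDE (@lt_irrefl _ (ord α).toPreorder D)
      refine (h1 (Sum.inr D) (Sum.inr E) ?_).trans (if_neg fun e => hne (Sum.inr_injective e))
      -- If `D` had larger total degree than `E`, then `hord` would place `E` before `D`.
      by_contra! hcon
      exact @lt_asymm _ (ord α).toPreorder _ _ hDE (hord α E D hcon)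
    · intro D
      exact (h1 (Sum.inr D) (Sum.inr D) le_rfl).trans (if_pos rfl)
  · intro h
    refine (F.mem_unip_iff_linPart φ).2 fun α => ?_
    obtain ⟨B, C, hBC, -⟩ := h α
    ext ρ τ
    refine (F.toGL_apply_same φ α _ _).trans ?_
    exact congrFun (congrFun hBC (Sum.inl ρ)) (Sum.inl τ)

lemma isOneParameterSubgroup_invDistinguished :
    IsOneParameterSubgroup (F.invDistinguished k) := by
  refine ⟨Matrix.diagonal fun i => LaurentPolynomial.T (F.indexDegree i), fun t i j => ?_⟩
  rw [(F.isContracted (k := k)).lam_eq, Matrix.diagonal_apply, Matrix.diagonal_apply]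
  split_ifs
  · rw [LaurentPolynomial.eval₂_T]
    simp
  · rw [map_zero]

lemma isOneParameterSubgroup_distinguished :
    IsOneParameterSubgroup ((F.toGL k).comp (F.distinguished k)) := by
  refine ⟨Matrix.diagonal fun i => LaurentPolynomial.T (-(F.indexDegree i : ℤ)), fun t i j => ?_⟩
  change (F.toGL k (F.distinguished k t)).1 i j = _
  rw [toGL_distinguished, Matrix.diagonal_apply, Matrix.diagonal_apply]
  split_ifs
  · rw [LaurentPolynomial.eval₂_T]
    simp
  · rw [map_zero]

end ToricCox.CompleteFan

end

theorem mainTheorem6 {k : Type*} [Field k] [IsAlgClosed k] [CharZero k] {n : ℕ}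
    (F : ToricCox.CompleteFan n)
    (ord : ∀ α : F.VarClass, LinearOrder (F.NonLin α))
    (hord : ∀ (α : F.VarClass) (D E : F.NonLin α),
      D.1.degree < E.1.degree → (ord α).lt D E) :
    ∃ U R : Subgroup (GL F.Index k),
      ToricCox.IsLeviDecomposition (F.toGL k).range R U ∧
      (∀ φ : F.autGr k, F.toGL k φ ∈ U ↔
        ∀ α : F.VarClass, ∃ (B : Matrix (F.NonLin α) (F.Lin α) k)
          (C : Matrix (F.NonLin α) (F.NonLin α) k),
          F.blockMatrix φ α = Matrix.fromBlocks 1 0 B C ∧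
            ToricCox.IsLowerUnitriangular (ord α) C) ∧
      ToricCox.IsCentralOneParameterSubgroup ((F.toGL k).comp (F.distinguished k)) R ∧
      ToricCox.IsPositivelyGraded
        (fun t => ToricCox.conj (F.toGL k (F.distinguished k t⁻¹))) (ToricCox.lieAlg U) ∧
      ToricCox.HasGradedUnipotentRadical (F.toGL k).range := by
  have h := F.isContracted (k := k)
  have hlevi := h.isLeviDecomposition F.eq_bot_of_normal_isUnipotent
  have hlam : ∀ t, ((F.toGL k).comp (F.distinguished k)) t = F.invDistinguished k t⁻¹ := fun t => by
    change _ = F.toGL k (F.distinguished k t⁻¹⁻¹)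
    rw [inv_inv]
    rfl
  -- The same weight computation serves parts (2) and (3): `F.invDistinguished k t` is by definition
  -- `λ_g(t⁻¹)`.
  refine ⟨h.unip, h.levi, hlevi, F.mem_unip_iff_blockMatrix ord hord,
    ⟨F.isOneParameterSubgroup_distinguished, fun t => ?_⟩, h.isPositivelyGraded,
    h.levi, h.unip, F.invDistinguished k, hlevi,
    ⟨F.isOneParameterSubgroup_invDistinguished, fun t => ⟨h.lam_mem_levi t, fun r hr =>
      h.lam_comm t hr⟩⟩, h.isPositivelyGraded⟩
  rw [hlam]
  exact ⟨h.lam_mem_levi _, fun r hr => h.lam_comm _ hr⟩
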